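/- **Proposition 2.1.** Let $n\ge 3$ and let $\Phi_n:\mathbb P^2\dashrightarrow\mathbb P^2$ be the birational map of the complex projective plane $$\Phi_n(x:y:z)=(xz^{n-1}+y^n : yz^{n-1} : z^n).$$ Let $P=(1:0:0)$, $\Delta=\{z=0\}$, and use the affine coordinates $(y,z)$ on the chart $x=1$, so that $P=(0,0)_{(y,z)}$. Put $s=z/y$, and for $k\ge 0$ $$\rho_k=\frac{y^{k+1}}{z^k},\qquad \beta_k=\frac{y^nz^{-(n-1)}+1}{s^k},\qquad \gamma_k=\frac{y^nz^{-(n-1)}-1}{s^k}.$$ Each of the pairs $(\rho_k,s)$, $(\beta_k,s)$, $(\gamma_k,s)$ below is a system of coordinates on an affine chart $\mathbb C^2$ of the surface obtained by blowing up the preceding points of the list in which the point occurs. For $0\le k\le n-2$ set $$A_k=(0,0)_{(\rho_k,s)},\qquad B_k=(0,0)_{(\beta_k,s)},\qquad C_k=(0,0)_{(\gamma_k,s)},$$ and write $P_1=A_0$, $T=B_0$, $S=C_0$ (thus $T=(-1,0)$ and $S=(1,0)$ in the coordinates $(y^n/z^{n-1},\,z/y)$). Let $$\widehat\xi_1=(P,P_1,A_1,\dots,A_{n-2},T,B_1,\dots,B_{n-2}),\qquad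 \widehat\xi_2=(P,P_1,A_1,\dots,A_{n-2},S,C_1,\dots,C_{n-2}).$$ Then $\widehat\xi_1$ and $\widehat\xi_2$ are points of length $2n-1$ infinitely near $P$: each member is a closed point of the surface obtained by blowing up the preceding ones, and it lies on the exceptional curve of the blowup of its immediate predecessor. Let $\mathrm{Bl}_{\widehat\xi_1}\mathbb P^2$ and $\mathrm{Bl}_{\widehat\xi_2}\mathbb P^2$ be the surfaces obtained by blowing up all these points. Say that a surface $\widetilde X$ is the *minimal desingularization* of a birational map $f:\mathbb P^2\dashrightarrow\mathbb P^2$ if it is obtained from $\mathbb P^2$ by a finite sequence of blowups of closed points whose composition $\pi$ makes $f\circ\pi$ regular, and if every other surface with these properties is obtained from $\widetilde X$ by a finite sequence of blowups of closed points. Then: 1. $\mathrm{Bl}_{\widehat\xi_1}\mathbb P^2$ is the minimal desingularization of $\Phi_n$, and $\mathrm{Bl}_{\widehat\xi_2}\mathbb P^2$ is the minimal desingularization of $\Phi_n^{-1}$. 2. $\Phi_n$ induces an isomorphism $\mathrm{Bl}_{\widehat\xi_1}\mathbb P^2\to\mathrm{Bl}_{\widehat\xi_2}\mathbb P^2$.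 3. Denote by $\mathbf E$ the exceptional curve of the blowup of $P$, and by $\mathbf G^k,\mathbf L^k,\mathbf M^k$ those of the blowups of $A_k,B_k,C_k$ respectively ($0\le k\le n-2$); put $\mathbf F=\mathbf G^0$, $\mathbf H=\mathbf L^0$, $\mathbf K=\mathbf M^0$. Use the same letters, and $\Delta$, for the strict transforms of these curves. The isomorphism maps $$\Delta\to\mathbf M^{n-2},\qquad \mathbf E\to\mathbf E,\qquad \mathbf G^{n-2}\to\mathbf G^{n-2},\qquad \mathbf L^{n-2}\to\Delta,$$ $$\mathbf G^k\to\mathbf M^{n-3-k}\quad\text{and}\quad \mathbf L^k\to\mathbf G^{n-3-k}\qquad\text{for } 0\le k\le n-3.$$ In particular $\mathbf F\to\mathbf M^{n-3}$, $\mathbf G^{n-3}\to\mathbf K$, $\mathbf H\to\mathbf G^{n-3}$ and $\mathbf L^{n-3}\to\mathbf F$. -/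

import Mathlib

/-!
Surfaces are handled as Zariski models: an integral separated scheme of finite type over `ℂ` with
function field `K` is the set of its local rings `𝒪_{X,p} ⊆ K` (one for each scheme-theoretic
point `p`: the closed points, the generic points of the curves, and the generic point of the
surface, whose local ring is `K`).  So

* a surface birational to the plane is a set `X` of local subrings of `K = ℂ(ℙ²)`;
* a curve on `X` is given by its generic point, a discrete valuation ring of `K` lying in `X`.
  Since `X` and a blowup of `X` have the same function field, the generic point of the strict
  transform of a curve is the same discrete valuation ring as that of the curve;
* a birational map `f : X ⇢ Y` is given by its comorphism `φ = f^* : ℂ(Y) → ℂ(X)`, `g ↦ g ∘ f`;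
  `f` is regular and maps `p` to `q` exactly when `𝒪_{X,p}` dominates `φ(𝒪_{Y,q})`.

In Mathlib, `R ≤ S` for local subrings means that `S` dominates `R`.
-/

noncomputable section

namespace ZariskiModel

variable {K : Type*} [Field K]

/-- The local rings of the affine scheme `Spec A`, where `A` is a subring of `K`. -/
def affineModel (A : Subring K) : Set (LocalSubring K) :=
  {R | ∃ (p : Ideal A) (_ : p.IsPrime), R = LocalSubring.ofPrime A p}

/-- The affine blowup algebra `R[m / a]`, where `m` is the maximal ideal of the local ring `R`. -/
def blowupAlgebra (R : LocalSubring K) (a : K) : Subring K :=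
  Subring.closure ((R.toSubring : Set K) ∪
    {t | ∃ x ∈ IsLocalRing.maximalIdeal R.toSubring, t = (x : K) / a})

/-- The points lying over the closed point in the blowup of `Spec R` at its closed point, i.e. the
points of the fibre of the blowup of a surface over its centre.  The blowup of `Spec R` is covered
by the affine schemes `Spec R[m / a]`, with `a` a nonzero element of the maximal ideal `m`, and a
point of it lies over the closed point of `Spec R` exactly when its local ring dominates `R`. -/
def exceptionalFibre (R : LocalSubring K) : Set (LocalSubring K) :=
  {S | R ≤ S ∧ ∃ a ∈ IsLocalRing.maximalIdeal R.toSubring, (a : K) ≠ 0 ∧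
    S ∈ affineModel (blowupAlgebra R (a : K))}

/-- The blowup of the surface `X` at the closed point with local ring `R`: this point is replaced
by the points of the exceptional fibre, the other points are unchanged. -/
def blowup (X : Set (LocalSubring K)) (R : LocalSubring K) : Set (LocalSubring K) :=
  (X \ {R}) ∪ exceptionalFibre R

/-- `D` is the (local ring of the) generic point of the exceptional curve of the blowup of the
point `R`. -/
def IsExceptionalCurve (R D : LocalSubring K) : Prop :=
  D ∈ exceptionalFibre R ∧ IsDiscreteValuationRing D.toSubring

instance : Nonempty (LocalSubring K) := ⟨LocalSubring.mk ⊤⟩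

/-- The generic point of the exceptional curve of the blowup of the point `R`; it exists and is
unique if `R` is a closed point of a smooth surface. -/
def exceptionalCurve (R : LocalSubring K) : LocalSubring K :=
  Classical.epsilon (IsExceptionalCurve R)

/-- The surface obtained from `X` by blowing up successively the points of the list. -/
def blowupList (X : Set (LocalSubring K)) (L : List (LocalSubring K)) : Set (LocalSubring K) :=
  L.foldl blowup X

variable [Algebra ℂ K]

/-- `R` is the local ring of a closed point of a complex surface: its residue field is `ℂ`. -/
def IsClosedPoint (R : LocalSubring K) : Prop :=
  ∀ x ∈ R.toSubring, ∃ c : ℂ, ∃ m ∈ IsLocalRing.maximalIdeal R.toSubring,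
    x = algebraMap ℂ K c + (m : K)

/-- The members of the list are successively closed points of `X`, of the blowup of `X` at the
first one, of the blowup of that at the second one, and so on. -/
def AreSuccessiveCentres :
    Set (LocalSubring K) → List (LocalSubring K) → Prop
  | _, [] => True
  | X, R :: L => R ∈ X ∧ IsClosedPoint R ∧ AreSuccessiveCentres (blowup X R) L

/-- `L = (p₁, …, p_d)` is a point of length `d` infinitely near the closed point `R` of `X`:
`p₁ = R`, every member is a closed point on the surface obtained by blowing up the previous ones,
and every `p_{i+1}` lies on the exceptional curve of the blowup of `p_i`. -/
def IsInfinitelyNear (X : Set (LocalSubring K)) (R : LocalSubring K) (d : ℕ)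
    (L : List (LocalSubring K)) : Prop :=
  L.length = d ∧ L.head? = some R ∧ AreSuccessiveCentres X L ∧
    L.IsChain (fun p q => q ∈ exceptionalFibre p)

/-- `X'` is obtained from `X` by a finite sequence of blowups at closed points. -/
def IsIteratedBlowup (X X' : Set (LocalSubring K)) : Prop :=
  Relation.ReflTransGen (fun Y Y' => ∃ R ∈ Y, IsClosedPoint R ∧ Y' = blowup Y R) X X'

/-- The image of a local subring under an automorphism of `K`. -/
def image (φ : K ≃ₐ[ℂ] K) (S : LocalSubring K) : LocalSubring K :=
  S.map (φ : K →+* K)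

/-- The birational map `X ⇢ Y` with comorphism `φ` is regular on the whole of `X`. -/
def IsRegularMap (φ : K ≃ₐ[ℂ] K) (X Y : Set (LocalSubring K)) : Prop :=
  ∀ R ∈ X, ∃ S ∈ Y, image φ S ≤ R

/-- The birational map `X ⇢ Y` with comorphism `φ` is an isomorphism: `φ` maps the local rings of
`Y` onto the local rings of `X`. -/
def IsIsomorphism (φ : K ≃ₐ[ℂ] K) (X Y : Set (LocalSubring K)) : Prop :=
  image φ '' Y = X

/-- `X'` is the minimal desingularization of the birational map `f : X ⇢ Y` with comorphism `φ`:
it is obtained from `X` by a finite sequence of blowups, the composition of `f` with these blowups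
is regular, and every other surface with these properties is obtained from `X'` by a finite
sequence of blowups. -/
def IsMinimalDesingularization (φ : K ≃ₐ[ℂ] K) (X Y X' : Set (LocalSubring K)) : Prop :=
  IsIteratedBlowup X X' ∧ IsRegularMap φ X' Y ∧
    ∀ X'', IsIteratedBlowup X X'' → IsRegularMap φ X'' Y → IsIteratedBlowup X' X''

/-- The birational map `X ⇢ Y` with comorphism `φ` maps the curve on `X` with generic point `D`
onto the curve on `Y` with generic point `D'`, isomorphically at the generic points. -/
def MapsCurve (φ : K ≃ₐ[ℂ] K) (X Y : Set (LocalSubring K)) (D D' : LocalSubring K) : Prop :=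
  D ∈ X ∧ D' ∈ Y ∧ IsDiscreteValuationRing D.toSubring ∧ image φ D' = D

/-- The coordinate ring `ℂ[u, v] ⊆ K` of an affine chart with coordinates `u, v`. -/
def coordRing (u v : K) : Subring K :=
  (Algebra.adjoin ℂ {u, v}).toSubring

open Classical in
/-- The localization of `A` at the prime ideal `p` (and `K` if `p` is not prime). -/
def localizationAt (A : Subring K) (p : Ideal A) : LocalSubring K :=
  if h : p.IsPrime then @LocalSubring.ofPrime K _ A p h else LocalSubring.mk ⊤

/-- The local ring of the point `(0, 0)_{(u, v)}`, i.e. the point `u = v = 0` of the chart with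
coordinates `u, v`. -/
def originAt (u v : K) : LocalSubring K :=
  localizationAt (coordRing u v) (Ideal.span {f | (f : K) = u ∨ (f : K) = v})

end ZariskiModel

open ZariskiModel

/-- The function field `ℂ(ℙ²)`: rational functions of the two affine coordinates `y / x`
and `z / x`. -/
abbrev FunctionFieldP2 : Type := FractionRing (MvPolynomial (Fin 2) ℂ)

/-- The affine coordinate `y / x` of the plane (denoted `y`, on the chart `x = 1`). -/
def yP2 : FunctionFieldP2 := algebraMap (MvPolynomial (Fin 2) ℂ) _ (MvPolynomial.X 0)

/-- The affine coordinate `z / x` of the plane (denoted `z`, on the chart `x = 1`). -/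
def zP2 : FunctionFieldP2 := algebraMap (MvPolynomial (Fin 2) ℂ) _ (MvPolynomial.X 1)

/-- The homogeneous coordinates `(x : y : z)` of the generic point of the plane. -/
def homCoord : Fin 3 → FunctionFieldP2 := ![1, yP2, zP2]

/-- The complex projective plane: the union of its three standard affine charts, with coordinate
rings `ℂ[x / xᵢ, y / xᵢ, z / xᵢ]` for `xᵢ = x, y, z`. -/
def planeP2 : Set (LocalSubring FunctionFieldP2) :=
  ⋃ i : Fin 3, affineModel
    (Algebra.adjoin ℂ (Set.range fun j : Fin 3 => homCoord j / homCoord i)).toSubring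

/-- `φ` is the comorphism of the birational self-map `(f₀ : f₁ : f₂)` of the plane, for homogeneous
polynomials `fᵢ` of the same degree: `φ` maps the homogeneous coordinates of the generic point to a
vector proportional to the nonzero vector of the values of the `fᵢ`. -/
def IsComorphism (f : Fin 3 → MvPolynomial (Fin 3) ℂ)
    (φ : FunctionFieldP2 ≃ₐ[ℂ] FunctionFieldP2) : Prop :=
  (∃ i, MvPolynomial.aeval homCoord (f i) ≠ 0) ∧
    ∀ i j, φ (homCoord i) * MvPolynomial.aeval homCoord (f j) =
      φ (homCoord j) * MvPolynomial.aeval homCoord (f i)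

/-- The map `Φ_n = (x z^{n-1} + y^n : y z^{n-1} : z^n)`. -/
def PhiMap (n : ℕ) : Fin 3 → MvPolynomial (Fin 3) ℂ :=
  ![MvPolynomial.X 0 * MvPolynomial.X 2 ^ (n - 1) + MvPolynomial.X 1 ^ n,
    MvPolynomial.X 1 * MvPolynomial.X 2 ^ (n - 1),
    MvPolynomial.X 2 ^ n]

/-- The generic point of the line `Δ = {z = 0}`. -/
def lineDelta : LocalSubring FunctionFieldP2 :=
  localizationAt (coordRing yP2 zP2) (Ideal.span {f | (f : FunctionFieldP2) = zP2})

/-- The point `P = (1 : 0 : 0) = (0, 0)_{(y, z)}`. -/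
def pointP : LocalSubring FunctionFieldP2 := originAt yP2 zP2

/-- The coordinate `r_{k+1} = y^{k+1} / z^k`, i.e. `r_{k+1} = r_k / s` with `r_1 = u_1 = y`
and `s = z / y`. -/
def rCoord (k : ℕ) : FunctionFieldP2 := yP2 ^ (k + 1) / zP2 ^ k

/-- The coordinate `s = z / y`; it is `v_1` and all the `s_k, d_k` with `k ≥ 2`. -/
def sCoord : FunctionFieldP2 := zP2 / yP2

/-- The points `A_k = (0, 0)_{(r_{k+1}, s_{k+1})}` for `k ≥ 1`;
and `A_0` is the point `P_1 = (0, 0)_{(u_1, v_1)}`. -/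
def pointA (k : ℕ) : LocalSubring FunctionFieldP2 := originAt (rCoord k) sCoord

/-- The points `B_k = (0, 0)_{(r_{n+k}, s_{n+k})}` for `k ≥ 1`, where `r_{n+k} = (r_n + 1) / s^k`;
and `B_0` is the point `T = (-1, 0)_{(r_n, s_n)} = (0, 0)_{(r_n + 1, s_n)}`. -/
def pointB (n k : ℕ) : LocalSubring FunctionFieldP2 :=
  originAt ((rCoord (n - 1) + 1) / sCoord ^ k) sCoord

/-- The points `C_k = (0, 0)_{(c_{n+k}, d_{n+k})}` for `k ≥ 1`, where `c_{n+k} = (r_n - 1) / s^k`;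
and `C_0` is the point `S = (1, 0)_{(r_n, s_n)} = (0, 0)_{(r_n - 1, s_n)}`. -/
def pointC (n k : ℕ) : LocalSubring FunctionFieldP2 :=
  originAt ((rCoord (n - 1) - 1) / sCoord ^ k) sCoord

/-- `ξ̂₁ = (P, P_1, A_1, …, A_{n-2}, T, B_1, …, B_{n-2})`. -/
def xiOne (n : ℕ) : List (LocalSubring FunctionFieldP2) :=
  pointP :: ((List.range (n - 1)).map pointA ++ (List.range (n - 1)).map (pointB n))

/-- `ξ̂₂ = (P, P_1, A_1, …, A_{n-2}, S, C_1, …, C_{n-2})`. -/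
def xiTwo (n : ℕ) : List (LocalSubring FunctionFieldP2) :=
  pointP :: ((List.range (n - 1)).map pointA ++ (List.range (n - 1)).map (pointC n))

end

open ZariskiModel

/-! In the affine coordinates `x / z`, `y / z` the map is the shear `(x, y) ↦ (x + y ^ n, y)`, so
only the neighbourhood of `z = 0` matters. With `s = z / y` and `r = y ^ n / z ^ (n - 1)`, its
comorphism fixes `s` and sends `r` to `r / (r + 1)`. `IsShear ε n` allows `ε = ±1`; the inverse of a
shear is the shear with `-ε` (`IsShear.symm`), so one argument serves `Φ_n` and its inverse, `ξ̂₁`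
and `ξ̂₂`.

Write `r_k = rCoord k`, `d_k = (r + ε) / s ^ k` and `d'_k = (r - ε) / s ^ k`. Then `φ r_k = ε r_k /
d_0` for `k < n` and `φ d'_j = -1 / (d_0 s ^ j)`, where `d_0 s ^ j = r_{n-1-j} + ε s ^ j`. For `1 ≤
j ≤ n - 1`, along `s = 0` the coordinate `d'_j` therefore pulls back to `-1 / r_{n-1-j}`: the chain
of curves is reversed, with `Δ` as one of its ends (`IsShear.image_curveAt_dCoord`).

Isomorphism: `Located` records the centre of a local ring on the blown up surface by saying which
coordinates are small and which have a regular inverse. `Located.image_symm` checks, stratum by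
stratum, that a shear carries one such description to another. Hence each local ring of the source
dominates the image of a local ring of the target; the same holds for the inverse, and separatedness
turns the two dominations into equalities.

Minimality: blowups at distinct points commute, so an iterated blowup of `X` that no longer contains
the closed point `R` of `X` factors through the blowup of `R` (`IsIteratedBlowup.of_notMem`). It
remains to see that no centre survives on a surface where the map is regular. The generic point of
the last exceptional curve dominates every centre and corresponds to the generic point of `Δ`. If
the map were regular at a centre, the image would have to be that generic point, and the centre
would not be closed (`IsShear.not_image_le`). -/

noncomputable section

namespace ZariskiModel

/-! ### Domination of local subrings and localizations inside a field -/

section LocalSubring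

variable {K : Type*} [Field K] {R S T : LocalSubring K} {x y : K}

/-- `x` is (the image in `K` of) an element of the maximal ideal of `R`. -/
def Small (R : LocalSubring K) (x : K) : Prop :=
  ∃ m ∈ IsLocalRing.maximalIdeal R.toSubring, (m : K) = x

theorem Small.mem (h : Small R x) : x ∈ R.toSubring := by
  obtain ⟨m, _, rfl⟩ := h
  exact m.2

theorem small_iff_maximalIdeal (hx : x ∈ R.toSubring) :
    Small R x ↔ (⟨x, hx⟩ : R.toSubring) ∈ IsLocalRing.maximalIdeal R.toSubring := by
  constructor
  · rintro ⟨m, hm, rfl⟩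
    exact hm
  · exact fun h => ⟨_, h, rfl⟩

theorem Small.add (hx : Small R x) (hy : Small R y) : Small R (x + y) := by
  obtain ⟨m, hm, rfl⟩ := hx
  obtain ⟨m', hm', rfl⟩ := hy
  exact ⟨m + m', add_mem hm hm', rfl⟩

theorem Small.mul_left (hx : x ∈ R.toSubring) (hy : Small R y) : Small R (x * y) := by
  obtain ⟨m, hm, rfl⟩ := hy
  exact ⟨⟨x, hx⟩ * m, Ideal.mul_mem_left _ _ hm, rfl⟩

theorem Small.mul_right (hx : Small R x) (hy : y ∈ R.toSubring) : Small R (x * y) :=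
  mul_comm x y ▸ Small.mul_left hy hx

theorem Small.neg (hx : Small R x) : Small R (-x) := by
  obtain ⟨m, hm, rfl⟩ := hx
  exact ⟨-m, neg_mem hm, rfl⟩

theorem Small.sub (hx : Small R x) (hy : Small R y) : Small R (x - y) :=
  sub_eq_add_neg x y ▸ hx.add hy.neg

theorem Small.pow (hx : Small R x) {k : ℕ} (hk : k ≠ 0) : Small R (x ^ k) := by
  obtain ⟨k, rfl⟩ := Nat.exists_eq_succ_of_ne_zero hk
  rw [pow_succ]
  exact Small.mul_left (pow_mem hx.mem k) hx

theorem small_zero : Small R 0 := ⟨0, zero_mem _, rfl⟩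

theorem not_small_one : ¬ Small R 1 := by
  rw [small_iff_maximalIdeal (one_mem _)]
  exact fun h => h isUnit_one

theorem not_small_of_inv_mem (hx : x ≠ 0) (h : x⁻¹ ∈ R.toSubring) : ¬ Small R x := fun hs =>
  not_small_one (R := R) (by simpa [hx] using Small.mul_left h hs)

theorem inv_mem_of_not_small (hx : x ∈ R.toSubring) (h : ¬ Small R x) : x⁻¹ ∈ R.toSubring := by
  rw [small_iff_maximalIdeal hx, IsLocalRing.mem_maximalIdeal, mem_nonunits_iff, not_not] at h
  obtain ⟨u, hu⟩ := h
  have h1 : ((u⁻¹ : (R.toSubring)ˣ) : R.toSubring) * ⟨x, hx⟩ = 1 := by rw [← hu]; simp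
  have h2 : ((u⁻¹ : (R.toSubring)ˣ) : R.toSubring).1 * x = 1 := congrArg Subtype.val h1
  rw [← eq_inv_of_mul_eq_one_left h2]
  exact Subtype.prop _

theorem ne_zero_of_not_small (h : ¬ Small R x) : x ≠ 0 := by
  rintro rfl
  exact h small_zero

theorem small_or_inv_mem (hx : x ∈ R.toSubring) : Small R x ∨ x⁻¹ ∈ R.toSubring :=
  or_iff_not_imp_left.2 (inv_mem_of_not_small hx)

theorem Small.of_le (h : R ≤ S) (hx : Small R x) : Small S x := by
  obtain ⟨m, hm, rfl⟩ := hx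
  obtain ⟨h1, h2⟩ := h
  refine ⟨Subring.inclusion h1 m, ?_, rfl⟩
  exact fun hu => hm (h2.map_nonunit m hu)

theorem mem_of_le (h : R ≤ S) (hx : x ∈ R.toSubring) : x ∈ S.toSubring := h.1 hx

/-- A non-small element of `R` is a unit of `R`, hence a unit of `S`. -/
theorem Small.of_ge (h : R ≤ S) (hx : x ∈ R.toSubring) (hs : Small S x) : Small R x := by
  by_contra hn
  exact not_small_of_inv_mem (ne_zero_of_not_small hn)
    (mem_of_le h (inv_mem_of_not_small hx hn)) hs

theorem inv_mem_of_le (h : R ≤ S) (hx : x ∈ R.toSubring) (hx0 : x ≠ 0)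
    (hi : x⁻¹ ∈ S.toSubring) : x⁻¹ ∈ R.toSubring :=
  (small_or_inv_mem hx).resolve_left fun hs => not_small_of_inv_mem hx0 hi (hs.of_le h)

theorem le_of_small (h : R.toSubring ≤ S.toSubring) (hs : ∀ x, Small R x → Small S x) :
    R ≤ S := by
  refine ⟨h, ⟨fun a ha => ?_⟩⟩
  by_contra hn
  have h1 : Small R (a : K) := ⟨a, hn, rfl⟩
  exact (small_iff_maximalIdeal (h a.2)).1 (hs _ h1) ha

/-- If `S` lies between `R` and `T`, and `T` dominates both, then `S` dominates `R`. -/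
theorem le_of_le_of_le (h : R.toSubring ≤ S.toSubring) (hST : S ≤ T) (hRT : R ≤ T) : R ≤ S :=
  le_of_small h fun _ hx => (hx.of_le hRT).of_ge hST (h hx.mem)

theorem mul_mem_of_inv {b : K} (hx : x ∈ R.toSubring) (hb : b⁻¹ ∈ R.toSubring) :
    x / b ∈ R.toSubring := div_eq_mul_inv x b ▸ mul_mem hx hb

/-- `R` is a localization of the subring `A`. -/
def IsLocalizationOf (A : Subring K) (R : LocalSubring K) : Prop :=
  A ≤ R.toSubring ∧ ∀ r ∈ R.toSubring, ∃ a ∈ A, ∃ b ∈ A, b ≠ 0 ∧ b⁻¹ ∈ R.toSubring ∧ r = a / b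

theorem mem_ofPrime_iff (A : Subring K) (p : Ideal A) [p.IsPrime] :
    x ∈ (LocalSubring.ofPrime A p).toSubring ↔ ∃ a b : A, b ∉ p ∧ x = (a : K) / b := by
  constructor
  · intro hx
    obtain ⟨a, b, hab⟩ := IsLocalization.exists_mk'_eq p.primeCompl
      (⟨x, hx⟩ : (LocalSubring.ofPrime A p).toSubring)
    refine ⟨a, b, b.2, ?_⟩
    have h1 := IsLocalization.mk'_spec (M := p.primeCompl)
      (LocalSubring.ofPrime A p).toSubring a b
    rw [hab] at h1
    have h2 : x * ((b : A) : K) = a := congrArg Subtype.val h1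
    have hb : ((b : A) : K) ≠ 0 := fun h => b.2 ((Subtype.ext h : (b : A) = 0) ▸ zero_mem p)
    rw [eq_div_iff hb, h2]
  · rintro ⟨a, b, hb, rfl⟩
    have hb0 : (b : K) ≠ 0 := fun h => hb ((Subtype.ext h : (b : A) = 0) ▸ zero_mem p)
    have h1 := IsLocalization.mk'_spec (M := p.primeCompl)
      (LocalSubring.ofPrime A p).toSubring a ⟨b, hb⟩
    have h2 := congrArg Subtype.val h1
    have h3 : ((IsLocalization.mk' (LocalSubring.ofPrime A p).toSubring a
        (⟨b, hb⟩ : p.primeCompl) : (LocalSubring.ofPrime A p).toSubring) : K) = a / b :=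
      (eq_div_iff hb0).2 h2
    exact h3 ▸ Subtype.prop _

theorem small_ofPrime_iff {A : Subring K} (p : Ideal A) [p.IsPrime] (a : A) :
    Small (LocalSubring.ofPrime A p) (a : K) ↔ a ∈ p := by
  have ha : (a : K) ∈ (LocalSubring.ofPrime A p).toSubring := LocalSubring.le_ofPrime A p a.2
  rw [small_iff_maximalIdeal ha,
    ← IsLocalization.AtPrime.to_map_mem_maximal_iff (LocalSubring.ofPrime A p).toSubring p a]
  rfl

theorem isLocalizationOf_ofPrime (A : Subring K) (p : Ideal A) [p.IsPrime] :
    IsLocalizationOf A (LocalSubring.ofPrime A p) := by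
  refine ⟨LocalSubring.le_ofPrime A p, fun r hr => ?_⟩
  obtain ⟨a, b, hb, rfl⟩ := (mem_ofPrime_iff A p).1 hr
  have hs : ¬ Small (LocalSubring.ofPrime A p) (b : K) := by rwa [small_ofPrime_iff]
  exact ⟨a, a.2, b, b.2, ne_zero_of_not_small hs,
    inv_mem_of_not_small (LocalSubring.le_ofPrime A p b.2) hs, rfl⟩

/-- If `A ⊆ T`, the localization of `A` at the trace of the maximal ideal of `T` is dominated
by `T`. -/
theorem exists_mem_affineModel_le {A : Subring K} (h : A ≤ T.toSubring) :
    ∃ R ∈ affineModel A, R ≤ T := by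
  let f : A →+* T.toSubring := Subring.inclusion h
  let p : Ideal A := (IsLocalRing.maximalIdeal T.toSubring).comap f
  have hp : p.IsPrime := Ideal.IsPrime.comap f
  have key : ∀ a : A, a ∈ p ↔ Small T (a : K) := fun a =>
    (small_iff_maximalIdeal (h a.2)).symm
  have hu : ∀ b : A, b ∉ p → (b : K)⁻¹ ∈ T.toSubring := fun b hb =>
    inv_mem_of_not_small (h b.2) (by rwa [← key])
  refine ⟨LocalSubring.ofPrime A p, ⟨p, hp, rfl⟩, le_of_small (fun x hx => ?_) fun x hx => ?_⟩
  · obtain ⟨a, b, hb, rfl⟩ := (mem_ofPrime_iff A p).1 hx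
    exact mul_mem_of_inv (h a.2) (hu b hb)
  · obtain ⟨a, b, hb, rfl⟩ := (mem_ofPrime_iff A p).1 hx.mem
    have hb0 : (b : K) ≠ 0 := fun h => hb ((Subtype.ext h : (b : A) = 0) ▸ zero_mem p)
    have ha : Small (LocalSubring.ofPrime A p) (a : K) := by
      rw [← div_mul_cancel₀ (a : K) hb0]
      exact hx.mul_right (LocalSubring.le_ofPrime A p b.2)
    rw [small_ofPrime_iff, key] at ha
    rw [div_eq_mul_inv]
    exact ha.mul_right (hu b hb)

/-- Two localizations contained in each other's charts and dominated by the same local ring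
coincide. -/
theorem IsLocalizationOf.eq {A B : Subring K} (hR : IsLocalizationOf A R)
    (hS : IsLocalizationOf B S) (hAS : A ≤ S.toSubring) (hBR : B ≤ R.toSubring)
    (hRT : R ≤ T) (hST : S ≤ T) : R = S := by
  have aux : ∀ {A : Subring K} {R S : LocalSubring K}, IsLocalizationOf A R →
      A ≤ S.toSubring → R ≤ T → S ≤ T → R.toSubring ≤ S.toSubring := by
    intro A R S hR hAS hRT hST r hr
    obtain ⟨a, ha, b, hb, hb0, hbi, rfl⟩ := hR.2 r hr
    exact mul_mem_of_inv (hAS ha) (inv_mem_of_le hST (hAS hb) hb0 (mem_of_le hRT hbi))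
  exact LocalSubring.toSubring_injective
    (le_antisymm (aux hR hAS hRT hST) (aux hS hBR hST hRT))

/-- `R` dominates the localization of `A` at the trace of its maximal ideal, and two localizations
of `A` dominated by the same ring coincide. After this, points of a chart can be handled without
naming primes. -/
theorem mem_affineModel_iff {A : Subring K} : R ∈ affineModel A ↔ IsLocalizationOf A R := by
  constructor
  · rintro ⟨p, hp, rfl⟩
    exact isLocalizationOf_ofPrime A p
  · intro h
    obtain ⟨S, hS, hSR⟩ := exists_mem_affineModel_le h.1
    have hS' : IsLocalizationOf A S := by
      obtain ⟨p, hp, rfl⟩ := hS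
      exact isLocalizationOf_ofPrime A p
    rwa [h.eq hS' hS'.1 h.1 le_rfl hSR]

theorem IsLocalizationOf.of_le {A B : Subring K} (h : IsLocalizationOf A R) (hAB : A ≤ B)
    (hB : B ≤ R.toSubring) : IsLocalizationOf B R := by
  refine ⟨hB, fun r hr => ?_⟩
  obtain ⟨a, ha, b, hb, h'⟩ := h.2 r hr
  exact ⟨a, hAB ha, b, hAB hb, h'⟩

theorem not_small_mul (hx : x ∈ R.toSubring) (hy : y ∈ R.toSubring) (h : ¬ Small R x)
    (h' : ¬ Small R y) : ¬ Small R (x * y) := by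
  refine not_small_of_inv_mem
    (mul_ne_zero (ne_zero_of_not_small h) (ne_zero_of_not_small h')) ?_
  rw [mul_inv]
  exact mul_mem (inv_mem_of_not_small hx h) (inv_mem_of_not_small hy h')

/-- The hypotheses say that `p` is the trace on `A` of the maximal ideal of `T`, and `T` always
dominates the localization at that trace. -/
theorem ofPrime_le {A : Subring K} (p : Ideal A) [p.IsPrime] (h : A ≤ T.toSubring)
    (hp : ∀ a ∈ p, Small T (a : K)) (hp' : ∀ a ∉ p, ¬ Small T (a : K)) :
    LocalSubring.ofPrime A p ≤ T := by
  obtain ⟨R, ⟨q, hq, rfl⟩, hR⟩ := exists_mem_affineModel_le h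
  have : p = q := by
    ext a
    rw [← small_ofPrime_iff q]
    refine ⟨fun ha => (hp a ha).of_ge hR (LocalSubring.le_ofPrime A q a.2), fun ha => ?_⟩
    by_contra hn
    exact hp' a hn (ha.of_le hR)
  subst this
  exact hR

end LocalSubring

/-! ### Separatedness of blowups and factorization through them -/

section Blowup

variable {K : Type*} [Field K] {R S T : LocalSubring K} {X : Set (LocalSubring K)}

/-- Any two members of `X` dominated by the same local ring are equal. -/
def IsSeparatedModel (X : Set (LocalSubring K)) : Prop :=
  ∀ ⦃R⦄, R ∈ X → ∀ ⦃S⦄, S ∈ X → ∀ ⦃T⦄, R ≤ T → S ≤ T → R = S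

theorem IsSeparatedModel.eq_of_le (hX : IsSeparatedModel X) (hR : R ∈ X) (hS : S ∈ X)
    (h : R ≤ S) : R = S :=
  hX hR hS h le_rfl

theorem le_blowupAlgebra (R : LocalSubring K) (a : K) : R.toSubring ≤ blowupAlgebra R a :=
  fun _ hx => Subring.subset_closure (Or.inl hx)

theorem div_mem_blowupAlgebra {x : K} (hx : Small R x) (a : K) : x / a ∈ blowupAlgebra R a := by
  obtain ⟨m, hm, rfl⟩ := hx
  exact Subring.subset_closure (Or.inr ⟨m, hm, rfl⟩)

theorem blowupAlgebra_le {a : K} {B : Subring K} (hR : R.toSubring ≤ B)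
    (h : ∀ x, Small R x → x / a ∈ B) : blowupAlgebra R a ≤ B := by
  refine Subring.closure_le.2 ?_
  rintro t (ht | ⟨x, hx, rfl⟩)
  · exact hR ht
  · exact h _ ⟨x, hx, rfl⟩

theorem mem_exceptionalFibre_iff : S ∈ exceptionalFibre R ↔
    R ≤ S ∧ ∃ a, Small R a ∧ a ≠ 0 ∧ IsLocalizationOf (blowupAlgebra R a) S := by
  constructor
  · rintro ⟨h, a, ha, ha0, hS⟩
    exact ⟨h, a, ⟨a, ha, rfl⟩, ha0, mem_affineModel_iff.1 hS⟩
  · rintro ⟨h, _, ⟨a, ha, rfl⟩, ha0, hS⟩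
    exact ⟨h, a, ha, ha0, mem_affineModel_iff.2 hS⟩

/-- If `S` lies in the chart of `a`, `S'` in the chart of `b`, and `T` dominates both, then `b / a`
is regular on `S` and invertible on `T`, hence invertible on `S`. So `S` contains the chart of `b`;
by symmetry both rings are localizations of overlapping charts. -/
theorem isSeparatedModel_exceptionalFibre (R : LocalSubring K) :
    IsSeparatedModel (exceptionalFibre R) := by
  have aux : ∀ {S S' T : LocalSubring K} {a b : K}, Small R a → a ≠ 0 → Small R b → b ≠ 0 →
      R ≤ S → IsLocalizationOf (blowupAlgebra R a) S → IsLocalizationOf (blowupAlgebra R b) S' →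
      S ≤ T → S' ≤ T → blowupAlgebra R b ≤ S.toSubring := by
    intro S S' T a b ha ha0 hb hb0 hRS hS hS' hST hST'
    have h1 : b / a ∈ S.toSubring := hS.1 (div_mem_blowupAlgebra hb a)
    have h2 : a / b ∈ T.toSubring := mem_of_le hST' (hS'.1 (div_mem_blowupAlgebra ha b))
    have h3 : (b / a)⁻¹ ∈ S.toSubring :=
      inv_mem_of_le hST h1 (div_ne_zero hb0 ha0) (by rwa [inv_div])
    refine blowupAlgebra_le hRS.1 fun x hx => ?_
    have h4 : x / b = x / a * (b / a)⁻¹ := by field_simp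
    rw [h4]
    exact mul_mem (hS.1 (div_mem_blowupAlgebra hx a)) h3
  intro S hS S' hS' T hST hST'
  obtain ⟨hRS, a, ha, ha0, hSa⟩ := mem_exceptionalFibre_iff.1 hS
  obtain ⟨hRS', b, hb, hb0, hSb⟩ := mem_exceptionalFibre_iff.1 hS'
  exact hSa.eq hSb (aux hb hb0 ha ha0 hRS' hSb hSa hST' hST)
    (aux ha ha0 hb hb0 hRS hSa hSb hST hST') hST hST'

/-- An unchanged point and a point over `R` cannot be dominated by the same ring: separatedness of
`X` would make the unchanged point equal to `R`. -/
theorem IsSeparatedModel.blowup (hX : IsSeparatedModel X) (hR : R ∈ X) :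
    IsSeparatedModel (blowup X R) := by
  have aux : ∀ {S S' T : LocalSubring K}, S ∈ X \ {R} → S' ∈ exceptionalFibre R →
      S ≤ T → S' ≤ T → False := fun hS hS' h h' =>
    hS.2 (hX hS.1 hR h (hS'.1.trans h'))
  rintro S (hS | hS) S' (hS' | hS') T h h'
  · exact hX hS.1 hS'.1 h h'
  · exact (aux hS hS' h h').elim
  · exact (aux hS' hS h' h).elim
  · exact isSeparatedModel_exceptionalFibre R hS hS' h h'

theorem exists_le_of_mem_blowup (hR : R ∈ X) (hS : S ∈ blowup X R) : ∃ S' ∈ X, S' ≤ S := by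
  rcases hS with hS | hS
  · exact ⟨S, hS.1, le_rfl⟩
  · exact ⟨R, hR, hS.1⟩

/-- By separatedness neither centre lies in the exceptional fibre of the other, so the two
replacements do not interfere. -/
theorem blowup_comm (hX : IsSeparatedModel X) (hR : R ∈ X) (hS : S ∈ X) (h : R ≠ S) :
    blowup (blowup X R) S = blowup (blowup X S) R := by
  have h1 : R ∉ exceptionalFibre S := fun h' => h (hX.eq_of_le hS hR h'.1).symm
  have h2 : S ∉ exceptionalFibre R := fun h' => h (hX.eq_of_le hR hS h'.1)
  ext Q
  simp only [blowup, Set.mem_union, Set.mem_sdiff, Set.mem_singleton_iff]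
  by_cases hQR : Q = R
  · subst hQR
    tauto
  · by_cases hQS : Q = S
    · subst hQS
      tauto
    · tauto

theorem mem_blowupList_of_notMem {L : List (LocalSubring K)} (hS : S ∈ X) (h : S ∉ L) :
    S ∈ blowupList X L := by
  induction L generalizing X with
  | nil => exact hS
  | cons R L ih =>
    rw [List.mem_cons, not_or] at h
    exact ih (Or.inl ⟨hS, h.1⟩) h.2

theorem mem_blowupList_append {L L' : List (LocalSubring K)} (hS : S ∈ exceptionalFibre R)
    (h : S ∉ L') : S ∈ blowupList X (L ++ R :: L') := by
  rw [blowupList, List.foldl_append]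
  exact mem_blowupList_of_notMem (X := blowup _ R) (Or.inr hS) h

variable [Algebra ℂ K]

theorem IsIteratedBlowup.isSeparatedModel {X' : Set (LocalSubring K)}
    (h : IsIteratedBlowup X X') (hX : IsSeparatedModel X) : IsSeparatedModel X' := by
  induction h with
  | refl => exact hX
  | tail _ h ih =>
    obtain ⟨R, hR, -, rfl⟩ := h
    exact ih.blowup hR

theorem IsIteratedBlowup.exists_le {X' : Set (LocalSubring K)} (h : IsIteratedBlowup X X')
    (hS : S ∈ X') : ∃ S' ∈ X, S' ≤ S := by
  induction h generalizing S with
  | refl => exact ⟨S, hS, le_rfl⟩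
  | tail _ h ih =>
    obtain ⟨R, hR, -, rfl⟩ := h
    obtain ⟨Q, hQ, hQS⟩ := exists_le_of_mem_blowup hR hS
    obtain ⟨Q', hQ', h'⟩ := ih hQ
    exact ⟨Q', hQ', h'.trans hQS⟩

/-- An iterated blowup of `X` that does not contain the closed point `R` of `X` factors through
the blowup of `R`. -/
theorem IsIteratedBlowup.of_notMem {X' : Set (LocalSubring K)} (h : IsIteratedBlowup X X')
    (hX : IsSeparatedModel X) (hR : R ∈ X) (hR' : R ∉ X') :
    IsIteratedBlowup (ZariskiModel.blowup X R) X' := by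
  induction h using Relation.ReflTransGen.head_induction_on with
  | refl => exact (hR' hR).elim
  | head h h' ih =>
    obtain ⟨S, hS, hSc, rfl⟩ := h
    by_cases hRS : R = S
    · subst hRS
      exact h'
    · refine Relation.ReflTransGen.head ?_ (ih (hX.blowup hS) (Or.inl ⟨hR, hRS⟩))
      -- The first blowup is at some `S ≠ R`; commuting it past the blowup of `R` brings the latter
      -- to the front.
      exact ⟨S, Or.inl ⟨hS, fun h => hRS h.symm⟩, hSc, blowup_comm hX hS hR (Ne.symm hRS)⟩

theorem AreSuccessiveCentres.isIteratedBlowup {L : List (LocalSubring K)}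
    (h : AreSuccessiveCentres X L) : IsIteratedBlowup X (blowupList X L) := by
  induction L generalizing X with
  | nil => exact Relation.ReflTransGen.refl
  | cons R L ih => exact Relation.ReflTransGen.head ⟨R, h.1, h.2.1, rfl⟩ (ih h.2.2)

theorem AreSuccessiveCentres.isIteratedBlowup_of_notMem {X' : Set (LocalSubring K)}
    {L : List (LocalSubring K)} (h : AreSuccessiveCentres X L) (hX : IsSeparatedModel X)
    (hX' : IsIteratedBlowup X X') (hL : ∀ R ∈ L, R ∉ X') :
    IsIteratedBlowup (blowupList X L) X' := by
  induction L generalizing X with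
  | nil => exact hX'
  | cons R L ih =>
    exact ih h.2.2 (hX.blowup h.1) (hX'.of_notMem hX h.1 (hL R (by simp)))
      fun Q hQ => hL Q (by simp [hQ])

theorem areSuccessiveCentres_of_isChain {L : List (LocalSubring K)} (hR : R ∈ X)
    (hc : ∀ Q ∈ R :: L, IsClosedPoint Q)
    (h : (R :: L).IsChain fun p q => q ∈ exceptionalFibre p) :
    AreSuccessiveCentres X (R :: L) := by
  induction L generalizing X R with
  | nil => exact ⟨hR, hc R (by simp), trivial⟩
  | cons Q L ih =>
    rw [List.isChain_cons_cons] at h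
    exact ⟨hR, hc R (by simp), ih (Or.inr h.1) (fun Q' hQ' => hc Q' (by simp_all)) h.2⟩

end Blowup

/-! ### Charts: the origin, the curve `v = 0`, and the blowup of the origin -/

section Coordinates

open Polynomial

variable {K : Type*} [Field K] [Algebra ℂ K] {R S T : LocalSubring K} {u v x y : K}

/-- `u`, `v` are algebraically independent and generate the field `K` over `ℂ`. -/
def IsCoordinates (u v : K) : Prop :=
  AlgebraicIndependent ℂ ![u, v] ∧ ∀ E : IntermediateField ℂ K, u ∈ E → v ∈ E → E = ⊤

/-- Two generators of a field of transcendence degree 2 are algebraically independent, so a change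
of coordinates only requires the old ones to be rational in the new ones. -/
theorem IsCoordinates.of_forall_mem {u' v' : K} (h : IsCoordinates u v)
    (h' : ∀ E : IntermediateField ℂ K, u' ∈ E → v' ∈ E → u ∈ E ∧ v ∈ E) :
    IsCoordinates u' v' := by
  have hgen : ∀ E : IntermediateField ℂ K, u' ∈ E → v' ∈ E → E = ⊤ := fun E h1 h2 =>
    h.2 E (h' E h1 h2).1 (h' E h1 h2).2
  refine ⟨?_, hgen⟩
  have hadj : IntermediateField.adjoin ℂ (Set.range ![u', v']) = ⊤ :=
    hgen _ (IntermediateField.subset_adjoin _ _ ⟨0, rfl⟩)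
      (IntermediateField.subset_adjoin _ _ ⟨1, rfl⟩)
  have : Algebra.IsAlgebraic (Algebra.adjoin ℂ (Set.range ![u', v'])) K := by
    refine ⟨fun x => ?_⟩
    have hx : x ∈ IntermediateField.adjoin ℂ (Set.range ![u', v']) := hadj ▸ trivial
    obtain ⟨r, hr, s, hs, rfl⟩ := (IntermediateField.mem_adjoin_iff_div).1 hx
    rw [div_eq_mul_inv]
    exact (isAlgebraic_algebraMap (⟨r, hr⟩ : Algebra.adjoin ℂ (Set.range ![u', v']))).mul
      (isAlgebraic_algebraMap (⟨s, hs⟩ : Algebra.adjoin ℂ (Set.range ![u', v']))).inv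
  refine (Algebra.IsAlgebraic.isTranscendenceBasis_of_lift_le_trdeg_of_finite ℂ ![u', v'] ?_).1
  exact h.1.lift_cardinalMk_le_trdeg

theorem IsCoordinates.symm (h : IsCoordinates u v) : IsCoordinates v u :=
  h.of_forall_mem fun _ h1 h2 => ⟨h2, h1⟩

theorem IsCoordinates.left_ne_zero (h : IsCoordinates u v) : u ≠ 0 := h.1.ne_zero 0

theorem IsCoordinates.right_ne_zero (h : IsCoordinates u v) : v ≠ 0 := h.1.ne_zero 1

theorem IsCoordinates.div (h : IsCoordinates u v) : IsCoordinates (u / v) v :=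
  h.of_forall_mem fun E h1 h2 => ⟨by simpa [h.right_ne_zero] using E.mul_mem h1 h2, h2⟩

theorem IsCoordinates.add (h : IsCoordinates u v) (c : ℂ) :
    IsCoordinates (u + algebraMap ℂ K c) v :=
  h.of_forall_mem fun E h1 h2 => ⟨by simpa using E.sub_mem h1 (E.algebraMap_mem c), h2⟩

theorem IsCoordinates.sub (h : IsCoordinates u v) (c : ℂ) :
    IsCoordinates (u - algebraMap ℂ K c) v :=
  h.of_forall_mem fun E h1 h2 => ⟨by simpa using E.add_mem h1 (E.algebraMap_mem c), h2⟩

/-- `R` contains the constants. -/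
def ContainsConstants (R : LocalSubring K) : Prop := ∀ c : ℂ, algebraMap ℂ K c ∈ R.toSubring

theorem ContainsConstants.of_le (hR : ContainsConstants R) (h : R ≤ S) : ContainsConstants S :=
  fun c => mem_of_le h (hR c)

theorem ContainsConstants.eq_zero_of_small (hR : ContainsConstants R) {c : ℂ}
    (h : Small R (algebraMap ℂ K c)) : c = 0 := by
  by_contra hc
  refine not_small_of_inv_mem ?_ (R := R) ?_ h
  · simpa using hc
  · rw [← map_inv₀]
    exact hR _

theorem ContainsConstants.adjoin_le (hR : ContainsConstants R) {s : Set K}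
    (h : ∀ x ∈ s, x ∈ R.toSubring) : (Algebra.adjoin ℂ s).toSubring ≤ R.toSubring := by
  intro x hx
  induction hx using Algebra.adjoin_induction with
  | mem x hx => exact h x hx
  | algebraMap c => exact hR c
  | add x y _ _ hx hy => exact add_mem hx hy
  | mul x y _ _ hx hy => exact mul_mem hx hy

theorem ContainsConstants.coordRing_le (hR : ContainsConstants R) (hu : u ∈ R.toSubring)
    (hv : v ∈ R.toSubring) : coordRing u v ≤ R.toSubring := by
  refine hR.adjoin_le ?_
  rintro x (rfl | rfl)
  exacts [hu, hv]

theorem algebraMap_mem_coordRing (u v : K) (c : ℂ) : algebraMap ℂ K c ∈ coordRing u v :=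
  (Algebra.adjoin ℂ {u, v}).algebraMap_mem c

theorem left_mem_coordRing (u v : K) : u ∈ coordRing u v :=
  Algebra.subset_adjoin (by simp)

theorem right_mem_coordRing (u v : K) : v ∈ coordRing u v :=
  Algebra.subset_adjoin (by simp)

theorem aeval_mem_coordRing (u v : K) (g : ℂ[X]) : aeval u g ∈ coordRing u v :=
  Algebra.adjoin_mono (by simp) (aeval_mem_adjoin_singleton ℂ u)

theorem containsConstants_of_coordRing_le (h : coordRing u v ≤ R.toSubring) :
    ContainsConstants R := fun c => h (algebraMap_mem_coordRing u v c)

theorem exists_eq_aeval_add_mul (hx : x ∈ coordRing u v) :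
    ∃ g : ℂ[X], ∃ h ∈ coordRing u v, x = aeval u g + v * h := by
  induction hx using Algebra.adjoin_induction with
  | mem x hx =>
    rcases hx with rfl | rfl
    · exact ⟨X, 0, zero_mem _, by simp⟩
    · exact ⟨0, 1, one_mem _, by simp⟩
  | algebraMap c => exact ⟨C c, 0, zero_mem _, by simp⟩
  | add x y _ _ hx hy =>
    obtain ⟨g, h, hh, rfl⟩ := hx
    obtain ⟨g', h', hh', rfl⟩ := hy
    exact ⟨g + g', h + h', add_mem hh hh', by rw [map_add]; ring⟩
  | mul x y _ _ hx hy =>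
    obtain ⟨g, h, hh, rfl⟩ := hx
    obtain ⟨g', h', hh', rfl⟩ := hy
    refine ⟨g * g', aeval u g * h' + aeval u g' * h + v * h * h', ?_, by rw [map_mul]; ring⟩
    exact add_mem (add_mem (mul_mem (aeval_mem_coordRing u v g) hh')
      (mul_mem (aeval_mem_coordRing u v g') hh))
      (mul_mem (mul_mem (right_mem_coordRing u v) hh) hh')

theorem exists_eq_const_add_mul_add_mul (hx : x ∈ coordRing u v) : ∃ c : ℂ,
    ∃ a ∈ coordRing u v, ∃ b ∈ coordRing u v, x = algebraMap ℂ K c + u * a + v * b := by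
  obtain ⟨g, h, hh, rfl⟩ := exists_eq_aeval_add_mul hx
  refine ⟨g.coeff 0, aeval u g.divX, aeval_mem_coordRing u v _, h, hh, ?_⟩
  conv_lhs => rw [← divX_mul_X_add g]
  simp only [map_add, map_mul, aeval_X, aeval_C]
  ring

/-- Restriction of functions to the line `v = 0`. Its kernel, and the kernel of its composite with
evaluation at `0`, show that the ideals of the curve and of the origin are prime. -/
theorem exists_residue_hom (h : AlgebraicIndependent ℂ ![u, v]) :
    ∃ π : coordRing u v →+* ℂ[X],
      (∀ a : coordRing u v, (a : K) = v → π a = 0) ∧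
      ∀ (a : coordRing u v) (g : ℂ[X]), (a : K) = aeval u g → π a = g := by
  have hr : Set.range ![u, v] = {u, v} := by
    simp [Matrix.range_cons, Matrix.range_empty, Set.pair_comm]
  have key : ∃ π : Algebra.adjoin ℂ (Set.range ![u, v]) →ₐ[ℂ] ℂ[X],
      (∀ a : Algebra.adjoin ℂ (Set.range ![u, v]), (a : K) = v → π a = 0) ∧
      (∀ a : Algebra.adjoin ℂ (Set.range ![u, v]), (a : K) = u → π a = X) := by
    refine ⟨(MvPolynomial.aeval ![X, 0]).comp h.aevalEquiv.symm.toAlgHom, ?_, ?_⟩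
    · intro a ha
      have : a = h.aevalEquiv (MvPolynomial.X 1) := Subtype.ext (by simp [ha])
      simp [this]
    · intro a ha
      have : a = h.aevalEquiv (MvPolynomial.X 0) := Subtype.ext (by simp [ha])
      simp [this]
  rw [hr] at key
  obtain ⟨π, h1, h2⟩ := key
  refine ⟨π.toRingHom, h1, fun a g ha => ?_⟩
  let u' : Algebra.adjoin ℂ {u, v} := ⟨u, left_mem_coordRing u v⟩
  have h3 : a = aeval u' g := Subtype.ext (by
    rw [ha]
    exact (Polynomial.aeval_algebraMap_apply K u' g))
  rw [h3]
  change π (aeval u' g) = g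
  rw [← aeval_algHom_apply, h2 u' rfl, aeval_X_left_apply]

/-- The generic point of the curve `v = 0` of the chart with coordinates `u`, `v`. -/
def curveAt (u v : K) : LocalSubring K :=
  localizationAt (coordRing u v) (Ideal.span {f | (f : K) = v})

theorem isPrime_span_curve (h : AlgebraicIndependent ℂ ![u, v]) :
    (Ideal.span {f : coordRing u v | (f : K) = v}).IsPrime := by
  obtain ⟨π, h1, h2⟩ := exists_residue_hom h
  have : Ideal.span {f : coordRing u v | (f : K) = v} = RingHom.ker π := by
    refine le_antisymm (Ideal.span_le.2 fun f hf => h1 f hf) fun f hf => ?_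
    obtain ⟨g, k, hk, hf'⟩ := exists_eq_aeval_add_mul f.2
    have h3 : f = ⟨aeval u g, aeval_mem_coordRing u v g⟩ +
        ⟨v, right_mem_coordRing u v⟩ * ⟨k, hk⟩ := Subtype.ext hf'
    have h4 : g = 0 := by
      have := (RingHom.mem_ker).1 hf
      rwa [h3, map_add, map_mul, h1 ⟨v, right_mem_coordRing u v⟩ rfl, zero_mul, add_zero,
        h2 _ g rfl] at this
    have h5 : f = ⟨v, right_mem_coordRing u v⟩ * ⟨k, hk⟩ := Subtype.ext (by simp [hf', h4])
    rw [h5]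
    exact Ideal.mul_mem_right _ _ (Ideal.subset_span rfl)
  rw [this]
  exact RingHom.ker_isPrime π

theorem isPrime_span_origin (h : AlgebraicIndependent ℂ ![u, v]) :
    (Ideal.span {f : coordRing u v | (f : K) = u ∨ (f : K) = v}).IsPrime := by
  obtain ⟨π, h1, h2⟩ := exists_residue_hom h
  let ψ := (evalRingHom (0 : ℂ)).comp π
  have hu : ∀ f : coordRing u v, (f : K) = u → ψ f = 0 := fun f hf => by
    simp [ψ, h2 f X (by simpa using hf)]
  have hv : ∀ f : coordRing u v, (f : K) = v → ψ f = 0 := fun f hf => by simp [ψ, h1 f hf]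
  have : Ideal.span {f : coordRing u v | (f : K) = u ∨ (f : K) = v} = RingHom.ker ψ := by
    refine le_antisymm (Ideal.span_le.2 fun f hf => hf.elim (hu f) (hv f)) fun f hf => ?_
    obtain ⟨c, a, ha, b, hb, hf'⟩ := exists_eq_const_add_mul_add_mul f.2
    have h3 : f = ⟨algebraMap ℂ K c, algebraMap_mem_coordRing u v c⟩ +
        ⟨u, left_mem_coordRing u v⟩ * ⟨a, ha⟩ +
        ⟨v, right_mem_coordRing u v⟩ * ⟨b, hb⟩ := Subtype.ext hf'
    have hc : ψ ⟨algebraMap ℂ K c, algebraMap_mem_coordRing u v c⟩ = c := by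
      simp [ψ, h2 ⟨algebraMap ℂ K c, algebraMap_mem_coordRing u v c⟩ (C c) (by simp)]
    have h4 : c = 0 := by
      have := (RingHom.mem_ker).1 hf
      rwa [h3, map_add, map_add, map_mul, map_mul, hu ⟨u, left_mem_coordRing u v⟩ rfl,
        hv ⟨v, right_mem_coordRing u v⟩ rfl, zero_mul, add_zero, zero_mul, add_zero, hc] at this
    have h5 : f = ⟨u, left_mem_coordRing u v⟩ * ⟨a, ha⟩ +
        ⟨v, right_mem_coordRing u v⟩ * ⟨b, hb⟩ := Subtype.ext (by simp [hf', h4])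
    rw [h5]
    exact add_mem (Ideal.mul_mem_right _ _ (Ideal.subset_span (Or.inl rfl)))
      (Ideal.mul_mem_right _ _ (Ideal.subset_span (Or.inr rfl)))
  rw [this]
  exact RingHom.ker_isPrime ψ

theorem curveAt_eq (h : IsCoordinates u v) : curveAt u v =
    @LocalSubring.ofPrime K _ (coordRing u v) _ (isPrime_span_curve h.1) :=
  dif_pos (isPrime_span_curve h.1)

theorem originAt_eq (h : IsCoordinates u v) : originAt u v =
    @LocalSubring.ofPrime K _ (coordRing u v) _ (isPrime_span_origin h.1) :=
  dif_pos (isPrime_span_origin h.1)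

theorem isLocalizationOf_curveAt (h : IsCoordinates u v) :
    IsLocalizationOf (coordRing u v) (curveAt u v) := by
  rw [curveAt_eq h]
  exact @isLocalizationOf_ofPrime K _ _ _ (isPrime_span_curve h.1)

theorem isLocalizationOf_originAt (h : IsCoordinates u v) :
    IsLocalizationOf (coordRing u v) (originAt u v) := by
  rw [originAt_eq h]
  exact @isLocalizationOf_ofPrime K _ _ _ (isPrime_span_origin h.1)

theorem containsConstants_curveAt (h : IsCoordinates u v) : ContainsConstants (curveAt u v) :=
  containsConstants_of_coordRing_le (isLocalizationOf_curveAt h).1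

theorem containsConstants_originAt (h : IsCoordinates u v) : ContainsConstants (originAt u v) :=
  containsConstants_of_coordRing_le (isLocalizationOf_originAt h).1

theorem small_curveAt (h : IsCoordinates u v) : Small (curveAt u v) v := by
  have := isPrime_span_curve h.1
  rw [curveAt_eq h]
  exact (small_ofPrime_iff _ ⟨v, right_mem_coordRing u v⟩).2 (Ideal.subset_span rfl)

theorem small_originAt_left (h : IsCoordinates u v) : Small (originAt u v) u := by
  have := isPrime_span_origin h.1
  rw [originAt_eq h]
  exact (small_ofPrime_iff _ ⟨u, left_mem_coordRing u v⟩).2 (Ideal.subset_span (Or.inl rfl))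

theorem small_originAt_right (h : IsCoordinates u v) : Small (originAt u v) v := by
  have := isPrime_span_origin h.1
  rw [originAt_eq h]
  exact (small_ofPrime_iff _ ⟨v, right_mem_coordRing u v⟩).2 (Ideal.subset_span (Or.inr rfl))

/-- The value of `x` at the point (or along the curve) `R` is not a constant. -/
def Nonconstant (R : LocalSubring K) (x : K) : Prop :=
  x ∈ R.toSubring ∧ ∀ c : ℂ, ¬ Small R (x - algebraMap ℂ K c)

theorem Nonconstant.not_isClosedPoint (h : Nonconstant R x) : ¬ IsClosedPoint R := by
  intro hR
  obtain ⟨c, m, hm, hx⟩ := hR x h.1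
  exact h.2 c ⟨m, hm, by rw [hx]; ring⟩

theorem Nonconstant.not_small (h : Nonconstant R x) : ¬ Small R x := by simpa using h.2 0

theorem Nonconstant.inv_mem (h : Nonconstant R x) : x⁻¹ ∈ R.toSubring :=
  inv_mem_of_not_small h.1 h.not_small

theorem Nonconstant.ne_zero (h : Nonconstant R x) : x ≠ 0 := ne_zero_of_not_small h.not_small

theorem Nonconstant.add_small (h : Nonconstant R x) (hy : Small R y) : Nonconstant R (x + y) := by
  refine ⟨add_mem h.1 hy.mem, fun c hc => h.2 c ?_⟩
  have := hc.sub hy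
  rwa [show x + y - algebraMap ℂ K c - y = x - algebraMap ℂ K c by ring] at this

theorem Nonconstant.mul_const (hR : ContainsConstants R) (h : Nonconstant R x) {c : ℂ}
    (hc : c ≠ 0) : Nonconstant R (algebraMap ℂ K c * x) := by
  refine ⟨mul_mem (hR c) h.1, fun d hd => h.2 (c⁻¹ * d) ?_⟩
  have h1 := hd.mul_left (hR c⁻¹)
  have h2 : algebraMap ℂ K c ≠ 0 := by simpa using hc
  rwa [show algebraMap ℂ K c⁻¹ * (algebraMap ℂ K c * x - algebraMap ℂ K d) =
    x - algebraMap ℂ K (c⁻¹ * d) by rw [map_mul, map_inv₀]; field_simp] at h1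

theorem Nonconstant.neg (hR : ContainsConstants R) (h : Nonconstant R x) :
    Nonconstant R (-x) := by
  simpa using h.mul_const hR (c := -1) (by simp)

theorem Nonconstant.inv (hR : ContainsConstants R) (h : Nonconstant R x) :
    Nonconstant R x⁻¹ := by
  refine ⟨h.inv_mem, fun c hc => ?_⟩
  have h1 := hc.mul_left h.1
  rw [mul_sub, mul_inv_cancel₀ h.ne_zero] at h1
  rcases eq_or_ne c 0 with rfl | hc0
  · exact not_small_one (by simpa using h1)
  · have h2 := (h1.mul_left (hR c⁻¹)).neg
    have h3 : algebraMap ℂ K c ≠ 0 := by simpa using hc0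
    refine h.2 c⁻¹ ?_
    rwa [show -(algebraMap ℂ K c⁻¹ * (1 - x * algebraMap ℂ K c)) = x - algebraMap ℂ K c⁻¹ by
      rw [map_inv₀]; field_simp; ring] at h2

/-- Over `ℂ` the polynomial splits, and each linear factor is a unit at `x`. Thus differing from
every constant already makes the residue of `x` transcendental. -/
theorem Nonconstant.aeval_not_small (hR : ContainsConstants R) (h : Nonconstant R x) {g : ℂ[X]}
    (hg : g ≠ 0) : ¬ Small R (aeval x g) := by
  have key : ∀ s : Multiset ℂ, aeval x (s.map fun a => X - C a).prod ∈ R.toSubring ∧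
      ¬ Small R (aeval x (s.map fun a => X - C a).prod) := by
    intro s
    induction s using Multiset.induction with
    | empty => exact ⟨by simp, by simpa using not_small_one⟩
    | cons a s ih =>
      have h1 : aeval x (X - C a) = x - algebraMap ℂ K a := by simp
      have h2 : x - algebraMap ℂ K a ∈ R.toSubring := sub_mem h.1 (hR a)
      rw [Multiset.map_cons, Multiset.prod_cons, map_mul, h1]
      exact ⟨mul_mem h2 ih.1, not_small_mul h2 ih.1 (h.2 a) ih.2⟩
  rw [(IsAlgClosed.splits g).eq_prod_roots, map_mul, aeval_C]
  refine not_small_mul (hR _) (key _).1 (fun h' => hg ?_) (key _).2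
  exact leadingCoeff_eq_zero.1 (hR.eq_zero_of_small h')

/-- Modulo `u` and `v` every function of the chart is a constant, and nonzero constants are units of
`T`. -/
theorem originAt_le (h : IsCoordinates u v) (hT : ContainsConstants T) (hu : Small T u)
    (hv : Small T v) : originAt u v ≤ T := by
  have := isPrime_span_origin h.1
  rw [originAt_eq h]
  have hA := hT.coordRing_le hu.mem hv.mem
  refine ofPrime_le _ hA (fun a ha => ?_) fun a ha hs => ha ?_
  · let f : coordRing u v →+* T.toSubring := Subring.inclusion hA
    have h1 : Ideal.span {f : coordRing u v | (f : K) = u ∨ (f : K) = v} ≤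
        (IsLocalRing.maximalIdeal T.toSubring).comap f := by
      refine Ideal.span_le.2 ?_
      rintro b (hb | hb)
      · exact (small_iff_maximalIdeal (hA b.2)).1 (by rwa [hb])
      · exact (small_iff_maximalIdeal (hA b.2)).1 (by rwa [hb])
    exact (small_iff_maximalIdeal (hA a.2)).2 (h1 ha)
  · obtain ⟨c, b, hb, d, hd, ha'⟩ := exists_eq_const_add_mul_add_mul a.2
    have h1 : Small T (u * b + v * d) :=
      (hu.mul_right (hA hb)).add (hv.mul_right (hA hd))
    have h2 : c = 0 := hT.eq_zero_of_small (by
      have := hs.sub h1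
      rwa [ha', show algebraMap ℂ K c + u * b + v * d - (u * b + v * d) =
        algebraMap ℂ K c by ring] at this)
    have h3 : a = ⟨u, left_mem_coordRing u v⟩ * ⟨b, hb⟩ +
        ⟨v, right_mem_coordRing u v⟩ * ⟨d, hd⟩ := Subtype.ext (by simp [ha', h2])
    rw [h3]
    exact add_mem (Ideal.mul_mem_right _ _ (Ideal.subset_span (Or.inl rfl)))
      (Ideal.mul_mem_right _ _ (Ideal.subset_span (Or.inr rfl)))

/-- Modulo `v` every function of the chart is a polynomial in `u`, which is small in `T` only if it
is zero. -/
theorem curveAt_le (h : IsCoordinates u v) (hT : ContainsConstants T) (hu : Nonconstant T u)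
    (hv : Small T v) : curveAt u v ≤ T := by
  have := isPrime_span_curve h.1
  rw [curveAt_eq h]
  have hA := hT.coordRing_le hu.1 hv.mem
  refine ofPrime_le _ hA (fun a ha => ?_) fun a ha hs => ha ?_
  · let f : coordRing u v →+* T.toSubring := Subring.inclusion hA
    have h1 : Ideal.span {f : coordRing u v | (f : K) = v} ≤
        (IsLocalRing.maximalIdeal T.toSubring).comap f := by
      refine Ideal.span_le.2 fun b hb => ?_
      have hb' : (b : K) = v := hb
      exact (small_iff_maximalIdeal (hA b.2)).1 (by rwa [hb'])
    exact (small_iff_maximalIdeal (hA a.2)).2 (h1 ha)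
  · obtain ⟨g, b, hb, ha'⟩ := exists_eq_aeval_add_mul a.2
    have h1 : Small T (aeval u g) := by
      have := hs.sub (hv.mul_right (hA hb))
      rwa [ha', add_sub_cancel_right] at this
    have h2 : g = 0 := by
      by_contra hg
      exact hu.aeval_not_small hT hg h1
    have h3 : a = ⟨v, right_mem_coordRing u v⟩ * ⟨b, hb⟩ := Subtype.ext (by simp [ha', h2])
    rw [h3]
    exact Ideal.mul_mem_right _ _ (Ideal.subset_span rfl)

theorem nonconstant_curveAt (h : IsCoordinates u v) : Nonconstant (curveAt u v) u := by
  refine ⟨(isLocalizationOf_curveAt h).1 (left_mem_coordRing u v), fun c hc => ?_⟩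
  have := isPrime_span_curve h.1
  rw [curveAt_eq h] at hc
  have h1 := (small_ofPrime_iff (Ideal.span {f : coordRing u v | (f : K) = v})
    ⟨u - algebraMap ℂ K c, sub_mem (left_mem_coordRing u v)
      (algebraMap_mem_coordRing u v c)⟩).1 hc
  obtain ⟨π, h2, h3⟩ := exists_residue_hom h.1
  have h4 : Ideal.span {f : coordRing u v | (f : K) = v} ≤ RingHom.ker π :=
    Ideal.span_le.2 fun f hf => h2 f hf
  have h5 := h3 ⟨u - algebraMap ℂ K c, sub_mem (left_mem_coordRing u v)
      (algebraMap_mem_coordRing u v c)⟩ (X - C c) (by simp)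
  have h6 := (RingHom.mem_ker).1 (h4 h1)
  rw [h5] at h6
  exact X_sub_C_ne_zero c h6

theorem not_isClosedPoint_curveAt (h : IsCoordinates u v) : ¬ IsClosedPoint (curveAt u v) :=
  (nonconstant_curveAt h).not_isClosedPoint

theorem originAt_comm (h : IsCoordinates u v) : originAt u v = originAt v u :=
  le_antisymm
    (originAt_le h (containsConstants_originAt h.symm) (small_originAt_right h.symm)
      (small_originAt_left h.symm))
    (originAt_le h.symm (containsConstants_originAt h) (small_originAt_right h)
      (small_originAt_left h))

theorem isClosedPoint_originAt (h : IsCoordinates u v) : IsClosedPoint (originAt u v) := by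
  have hC := containsConstants_originAt h
  have hL := isLocalizationOf_originAt h
  have key : ∀ a ∈ coordRing u v, ∃ c : ℂ, Small (originAt u v) (a - algebraMap ℂ K c) := by
    intro a ha
    obtain ⟨c, b, hb, d, hd, rfl⟩ := exists_eq_const_add_mul_add_mul ha
    refine ⟨c, ?_⟩
    rw [show algebraMap ℂ K c + u * b + v * d - algebraMap ℂ K c = u * b + v * d by ring]
    exact ((small_originAt_left h).mul_right (hL.1 hb)).add
      ((small_originAt_right h).mul_right (hL.1 hd))
  intro x hx
  obtain ⟨a, ha, b, hb, hb0, hbi, rfl⟩ := hL.2 x hx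
  obtain ⟨c, hc⟩ := key a ha
  obtain ⟨d, hd⟩ := key b hb
  have hd0 : d ≠ 0 := by
    rintro rfl
    exact not_small_of_inv_mem hb0 hbi (by simpa using hd)
  have hd0' : algebraMap ℂ K d ≠ 0 := by simpa using hd0
  obtain ⟨m, hm, hm'⟩ : Small (originAt u v) (a / b - algebraMap ℂ K (c / d)) := by
    have h1 := (((hc.mul_right (hC d)).sub (hd.mul_right (hC c))).mul_right
      (hC d⁻¹)).mul_right hbi
    rw [map_inv₀] at h1
    rw [map_div₀]
    convert h1 using 1
    field_simp
    ring
  exact ⟨c / d, m, hm, by rw [hm']; ring⟩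

theorem exists_of_small_originAt (h : IsCoordinates u v) (hx : Small (originAt u v) x) :
    ∃ a ∈ (originAt u v).toSubring, ∃ b ∈ (originAt u v).toSubring, x = u * a + v * b := by
  have hL := isLocalizationOf_originAt h
  obtain ⟨a, ha, b, hb, hb0, hbi, rfl⟩ := hL.2 x hx.mem
  obtain ⟨c, d, hd, e, he, rfl⟩ := exists_eq_const_add_mul_add_mul ha
  have h1 := hx.mul_right (hL.1 hb)
  rw [div_mul_cancel₀ _ hb0] at h1
  have h2 : c = 0 := (containsConstants_originAt h).eq_zero_of_small (by
    have := h1.sub (((small_originAt_left h).mul_right (hL.1 hd)).add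
      ((small_originAt_right h).mul_right (hL.1 he)))
    rwa [show algebraMap ℂ K c + u * d + v * e - (u * d + v * e) = algebraMap ℂ K c by ring]
      at this)
  exact ⟨d / b, mul_mem_of_inv (hL.1 hd) hbi, e / b, mul_mem_of_inv (hL.1 he) hbi, by
    rw [h2, map_zero]; ring⟩

theorem blowupAlgebra_originAt_le (h : IsCoordinates u v) (hT : originAt u v ≤ T)
    (huv : u / v ∈ T.toSubring) : blowupAlgebra (originAt u v) v ≤ T.toSubring := by
  refine blowupAlgebra_le hT.1 fun x hx => ?_
  obtain ⟨a, ha, b, hb, rfl⟩ := exists_of_small_originAt h hx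
  have hv := h.right_ne_zero
  rw [show (u * a + v * b) / v = u / v * a + b by field_simp]
  exact add_mem (mul_mem huv (mem_of_le hT ha)) (mem_of_le hT hb)

/-- `T` need not be a valuation ring, so it is centred on the blowup only when one of the two ratios
is regular: that is the indeterminacy of `(u : v)`. -/
theorem exists_mem_exceptionalFibre_le (h : IsCoordinates u v) (hT : originAt u v ≤ T)
    (huv : u / v ∈ T.toSubring ∨ v / u ∈ T.toSubring) :
    ∃ S ∈ exceptionalFibre (originAt u v), S ≤ T := by
  wlog huv' : u / v ∈ T.toSubring generalizing u v
  · rw [originAt_comm h] at hT ⊢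
    exact this h.symm hT huv.symm (huv.resolve_left huv')
  obtain ⟨S, hS, hST⟩ := exists_mem_affineModel_le (blowupAlgebra_originAt_le h hT huv')
  rw [mem_affineModel_iff] at hS
  refine ⟨S, mem_exceptionalFibre_iff.2 ⟨?_, v, small_originAt_right h, h.right_ne_zero, hS⟩,
    hST⟩
  exact le_of_le_of_le ((le_blowupAlgebra _ _).trans hS.1) hST hT

/-- The chart of `S` may come from any `x = u a + v b` in the maximal ideal. Since `(u / x) a + (v /
x) b = 1`, one of `u / x`, `v / x` is a unit of `S`. -/
theorem div_mem_or_of_mem_exceptionalFibre (h : IsCoordinates u v)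
    (hS : S ∈ exceptionalFibre (originAt u v)) : u / v ∈ S.toSubring ∨ v / u ∈ S.toSubring := by
  obtain ⟨hRS, x, hx, hx0, hS⟩ := mem_exceptionalFibre_iff.1 hS
  obtain ⟨a, ha, b, hb, rfl⟩ := exists_of_small_originAt h hx
  have hu := hS.1 (div_mem_blowupAlgebra (small_originAt_left h) (u * a + v * b))
  have hv := hS.1 (div_mem_blowupAlgebra (small_originAt_right h) (u * a + v * b))
  have hu0 := h.left_ne_zero
  have hv0 := h.right_ne_zero
  rcases small_or_inv_mem hu with h1 | h1
  · rcases small_or_inv_mem hv with h2 | h2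
    · refine (not_small_one (R := S) ?_).elim
      have := (h1.mul_right (mem_of_le hRS ha)).add (h2.mul_right (mem_of_le hRS hb))
      rwa [show u / (u * a + v * b) * a + v / (u * a + v * b) * b = 1 by field_simp] at this
    · left
      rw [show u / v = u / (u * a + v * b) * (v / (u * a + v * b))⁻¹ by field_simp]
      exact mul_mem hu h2
  · right
    rw [show v / u = v / (u * a + v * b) * (u / (u * a + v * b))⁻¹ by field_simp]
    exact mul_mem hv h1

theorem mem_exceptionalFibre_of_isLocalizationOf (h : IsCoordinates u v) {t : K}
    (hRS : originAt u v ≤ S) (huv : u / v ∈ S.toSubring)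
    (ht : t ∈ blowupAlgebra (originAt u v) v) (hS : IsLocalizationOf (coordRing t v) S) :
    S ∈ exceptionalFibre (originAt u v) := by
  refine mem_exceptionalFibre_iff.2 ⟨hRS, v, small_originAt_right h, h.right_ne_zero, ?_⟩
  refine hS.of_le (fun x hx => ?_) (blowupAlgebra_originAt_le h hRS huv)
  have hL := (isLocalizationOf_originAt h).1.trans (le_blowupAlgebra (originAt u v) v)
  induction hx using Algebra.adjoin_induction with
  | mem x hx =>
    rcases hx with rfl | rfl
    · exact ht
    · exact hL (right_mem_coordRing _ _)
  | algebraMap c => exact hL (algebraMap_mem_coordRing _ _ c)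
  | add x y _ _ hx hy => exact add_mem hx hy
  | mul x y _ _ hx hy => exact mul_mem hx hy

/-- This is the point of the exceptional line with direction `u / v = c`. -/
theorem originAt_mem_exceptionalFibre (h : IsCoordinates u v) (c : ℂ) :
    originAt (u / v - algebraMap ℂ K c) v ∈ exceptionalFibre (originAt u v) := by
  have h' := h.div.sub c
  have hC := containsConstants_originAt h'
  have huv : u / v ∈ (originAt (u / v - algebraMap ℂ K c) v).toSubring := by
    simpa using add_mem (small_originAt_left h').mem (hC c)
  refine mem_exceptionalFibre_of_isLocalizationOf h ?_ huv ?_ (isLocalizationOf_originAt h')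
  · refine originAt_le h hC ?_ (small_originAt_right h')
    simpa [h.right_ne_zero] using (small_originAt_right h').mul_left huv
  · exact sub_mem (div_mem_blowupAlgebra (small_originAt_left h) v)
      (le_blowupAlgebra _ _ (containsConstants_originAt h c))

theorem curveAt_mem_exceptionalFibre (h : IsCoordinates u v) :
    curveAt (u / v) v ∈ exceptionalFibre (originAt u v) := by
  have huv : u / v ∈ (curveAt (u / v) v).toSubring := (nonconstant_curveAt h.div).1
  refine mem_exceptionalFibre_of_isLocalizationOf h ?_ huv
    (div_mem_blowupAlgebra (small_originAt_left h) v) (isLocalizationOf_curveAt h.div)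
  refine originAt_le h (containsConstants_curveAt h.div) ?_ (small_curveAt h.div)
  simpa [h.right_ne_zero] using (small_curveAt h.div).mul_left huv

theorem curveAt_div_comm (h : IsCoordinates u v) : curveAt (u / v) v = curveAt (v / u) u := by
  have key : ∀ {u v : K}, IsCoordinates u v → curveAt (v / u) u ≤ curveAt (u / v) v := by
    intro u v h
    have hC := containsConstants_curveAt h.div
    have hN := nonconstant_curveAt h.div
    refine curveAt_le h.symm.div hC ?_ ?_
    · simpa using hN.inv hC
    · simpa [h.right_ne_zero] using (small_curveAt h.div).mul_left hN.1
  exact le_antisymm (key h.symm) (key h)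

/-- Otherwise `u / v` would be regular at every point over the origin, including the one where `v /
u` vanishes. -/
theorem div_notMem_originAt (h : IsCoordinates u v) : u / v ∉ (originAt u v).toSubring := by
  intro h1
  have h' : IsCoordinates (v / u) u := h.symm.div
  have h2 : originAt u v ≤ originAt (v / u) u := by
    refine originAt_le h (containsConstants_originAt h') (small_originAt_right h') ?_
    simpa [h.left_ne_zero] using (small_originAt_left h').mul_right (small_originAt_right h').mem
  refine not_small_of_inv_mem (div_ne_zero h.right_ne_zero h.left_ne_zero)
    (R := originAt (v / u) u) ?_ (small_originAt_left h')
  simpa using mem_of_le h2 h1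

theorem not_isDiscreteValuationRing_originAt (h : IsCoordinates u v) :
    ¬ IsDiscreteValuationRing (originAt u v).toSubring := by
  intro _
  have aux : ∀ {u v : K}, IsCoordinates u v → ∀ (hu : u ∈ (originAt u v).toSubring)
      (hv : v ∈ (originAt u v).toSubring),
      ¬ (⟨v, hv⟩ : (originAt u v).toSubring) ∣ ⟨u, hu⟩ := by
    rintro u v h hu hv ⟨⟨w, hw⟩, hd⟩
    have h1 : u = v * w := congrArg Subtype.val hd
    have hv0 := h.right_ne_zero
    refine div_notMem_originAt h ?_
    rwa [show u / v = w by rw [h1]; field_simp]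
  have hu := (small_originAt_left h).mem
  have hv := (small_originAt_right h).mem
  rcases ValuationRing.dvd_total (⟨u, hu⟩ : (originAt u v).toSubring) ⟨v, hv⟩ with h1 | h1
  · obtain ⟨⟨w, hw⟩, hd⟩ := h1
    have h2 : v = u * w := congrArg Subtype.val hd
    have h3 : v / u ∈ (originAt v u).toSubring := by
      rw [← originAt_comm h]
      have hu0 := h.left_ne_zero
      rwa [show v / u = w by rw [h2]; field_simp]
    exact div_notMem_originAt h.symm h3
  · exact aux h hu hv h1

theorem isDiscreteValuationRing_curveAt (h : IsCoordinates u v) :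
    IsDiscreteValuationRing (curveAt u v).toSubring := by
  have hp := isPrime_span_curve h.1
  have hN : IsNoetherianRing (coordRing u v) := by
    have : Algebra.FiniteType ℂ (Algebra.adjoin ℂ ({u, v} : Set K)) :=
      .adjoin_of_finite (by simp)
    exact Algebra.FiniteType.isNoetherianRing ℂ (Algebra.adjoin ℂ ({u, v} : Set K))
  have hN' : IsNoetherianRing (curveAt u v).toSubring := by
    rw [curveAt_eq h]
    exact IsLocalization.isNoetherianRing
      (Ideal.span {f : coordRing u v | (f : K) = v}).primeCompl _ hN
  have hL := isLocalizationOf_curveAt h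
  have hv := small_curveAt h
  have hF : ¬ IsField (curveAt u v).toSubring := by
    intro hF
    rw [IsLocalRing.isField_iff_maximalIdeal_eq] at hF
    have h1 := (small_iff_maximalIdeal hv.mem).1 hv
    rw [hF, Ideal.mem_bot] at h1
    exact h.right_ne_zero (congrArg Subtype.val h1)
  refine ((IsDiscreteValuationRing.TFAE _ hF).out 0 4).2 ?_
  refine ⟨⟨⟨v, hv.mem⟩, ?_⟩⟩
  change _ = Ideal.span {_}
  refine le_antisymm (fun x hx => ?_) ?_
  · have hx' : Small (curveAt u v) (x : K) := (small_iff_maximalIdeal x.2).2 hx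
    obtain ⟨a, ha, b, hb, hb0, hbi, hab⟩ := hL.2 x x.2
    obtain ⟨g, k, hk, rfl⟩ := exists_eq_aeval_add_mul ha
    have h1 := hx'.mul_right (hL.1 hb)
    rw [hab, div_mul_cancel₀ _ hb0] at h1
    have h2 : g = 0 := by
      by_contra hg
      refine (nonconstant_curveAt h).aeval_not_small (containsConstants_curveAt h) hg ?_
      simpa using h1.sub (hv.mul_right (hL.1 hk))
    refine Ideal.mem_span_singleton.2 ⟨⟨k / b, mul_mem_of_inv (hL.1 hk) hbi⟩, Subtype.ext ?_⟩
    simp only [hab, h2, map_zero, zero_add, Subring.coe_mul, mul_div_assoc]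
  · rw [Ideal.span_singleton_le_iff_mem]
    exact (small_iff_maximalIdeal hv.mem).1 hv

/-- On a point of the fibre where `u / v` is regular, either `u / v` is nonconstant and the point is
generic, or it takes a value `c` and the point is the origin of a chart, whose local ring is not a
valuation ring. Exchanging `u` and `v` covers the rest. -/
theorem isExceptionalCurve_iff (h : IsCoordinates u v) :
    IsExceptionalCurve (originAt u v) S ↔ S = curveAt (u / v) v := by
  constructor
  · rintro ⟨hS, hD⟩
    have hC : ContainsConstants S := (containsConstants_originAt h).of_le hS.1
    have hu := (small_originAt_left h).of_le hS.1
    have hv := (small_originAt_right h).of_le hS.1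
    have key : ∀ {a b : K}, IsCoordinates a b → a / b ∈ S.toSubring → Small S b →
        originAt a b = originAt u v → S = curveAt (a / b) b := by
      intro a b h' hab hb he
      by_cases hn : Nonconstant S (a / b)
      · refine isSeparatedModel_exceptionalFibre (originAt u v) hS
          (he ▸ curveAt_mem_exceptionalFibre h') le_rfl (curveAt_le h'.div hC hn hb)
      · rw [Nonconstant, not_and] at hn
        push Not at hn
        obtain ⟨c, hc⟩ := hn hab
        have h1 : S = originAt (a / b - algebraMap ℂ K c) b :=
          isSeparatedModel_exceptionalFibre (originAt u v) hS
            (he ▸ originAt_mem_exceptionalFibre h' c) le_rfl (originAt_le (h'.div.sub c) hC hc hb)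
        rw [h1] at hD
        exact (not_isDiscreteValuationRing_originAt (h'.div.sub c) hD).elim
    rcases div_mem_or_of_mem_exceptionalFibre h hS with h1 | h1
    · exact key h h1 hv rfl
    · rw [key h.symm h1 hu (originAt_comm h).symm, curveAt_div_comm h]
  · rintro rfl
    exact ⟨curveAt_mem_exceptionalFibre h, isDiscreteValuationRing_curveAt h.div⟩

theorem existsUnique_isExceptionalCurve (h : IsCoordinates u v) :
    ∃! D, IsExceptionalCurve (originAt u v) D :=
  ⟨_, (isExceptionalCurve_iff h).2 rfl, fun _ => (isExceptionalCurve_iff h).1⟩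

theorem exceptionalCurve_originAt (h : IsCoordinates u v) :
    exceptionalCurve (originAt u v) = curveAt (u / v) v :=
  (isExceptionalCurve_iff h).1 (Classical.epsilon_spec (existsUnique_isExceptionalCurve h).exists)

end Coordinates

/-! ### Points of the blowup of a chain of infinitely near points -/

section Chain

variable {K : Type*} [Field K] {X : Set (LocalSubring K)} {pt : ℕ → LocalSubring K} {N : ℕ}
  {S T : LocalSubring K}

theorem blowupList_map_range_succ (X : Set (LocalSubring K)) (pt : ℕ → LocalSubring K) (N : ℕ) :
    blowupList X ((List.range (N + 1)).map pt) =
      blowup (blowupList X ((List.range N).map pt)) (pt N) := by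
  simp [blowupList, List.range_succ]

theorem chain_le (h : ∀ i, i + 1 < N → pt (i + 1) ∈ exceptionalFibre (pt i)) {i j : ℕ}
    (hij : i ≤ j) (hj : j < N) : pt i ≤ pt j := by
  induction j, hij using Nat.le_induction with
  | base => exact le_rfl
  | succ j _ ih => exact (ih (by omega)).trans (h j hj).1

/-- The points of the surface obtained by blowing up a chain of infinitely near points. -/
theorem of_mem_blowupList_chain (hX : IsSeparatedModel X) (h0 : pt 0 ∈ X)
    (h : ∀ i, i + 1 < N → pt (i + 1) ∈ exceptionalFibre (pt i))
    (hS : S ∈ blowupList X ((List.range N).map pt)) :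
    (S ∈ X ∧ (0 < N → ¬ pt 0 ≤ S)) ∨
      ∃ i < N, S ∈ exceptionalFibre (pt i) ∧ (i + 1 < N → ¬ pt (i + 1) ≤ S) := by
  induction N with
  | zero => exact Or.inl ⟨hS, by simp⟩
  | succ N ih =>
    rw [blowupList_map_range_succ] at hS
    rcases hS with ⟨hS, hne⟩ | hS
    · rcases ih (fun i hi => h i (by omega)) hS with ⟨h1, h2⟩ | ⟨i, hi, h1, h2⟩
      · refine Or.inl ⟨h1, fun _ hle => ?_⟩
        rcases Nat.eq_zero_or_pos N with rfl | hN
        · exact hne (hX.eq_of_le h0 h1 hle).symm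
        · exact h2 hN hle
      · refine Or.inr ⟨i, by omega, h1, fun hi' hle => ?_⟩
        rcases Nat.lt_or_ge (i + 1) N with hlt | hge
        · exact h2 hlt hle
        · obtain rfl : N = i + 1 := by omega
          exact hne ((isSeparatedModel_exceptionalFibre _).eq_of_le (h i hi') h1 hle).symm
    · exact Or.inr ⟨N, by omega, hS, by omega⟩

/-- Every later centre dominates `pt (i + 1)`, so a ring `T` above `S` that does not dominate `pt (i
+ 1)` certifies that `S` is never blown up. -/
theorem mem_blowupList_chain_of_mem_exceptionalFibre
    (h : ∀ i, i + 1 < N → pt (i + 1) ∈ exceptionalFibre (pt i)) {i : ℕ} (hi : i < N)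
    (hS : S ∈ exceptionalFibre (pt i)) (hT : S ≤ T) (hi' : i + 1 < N → ¬ pt (i + 1) ≤ T) :
    S ∈ blowupList X ((List.range N).map pt) := by
  induction N with
  | zero => omega
  | succ N ih =>
    rw [blowupList_map_range_succ]
    rcases Nat.lt_or_ge i N with hlt | hge
    · refine Or.inl ⟨ih (fun i hi => h i (by omega)) hlt fun h' => hi' (by omega), ?_⟩
      rintro rfl
      exact hi' (by omega) ((chain_le h (by omega) (by omega)).trans hT)
    · obtain rfl : N = i := by omega
      exact Or.inr hS

theorem mem_blowupList_chain_of_mem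
    (h : ∀ i, i + 1 < N → pt (i + 1) ∈ exceptionalFibre (pt i))
    (hS : S ∈ X) (hT : S ≤ T) (h0 : ¬ pt 0 ≤ T) :
    S ∈ blowupList X ((List.range N).map pt) := by
  induction N with
  | zero => exact hS
  | succ N ih =>
    rw [blowupList_map_range_succ]
    refine Or.inl ⟨ih fun i hi => h i (by omega), ?_⟩
    rintro rfl
    exact h0 ((chain_le h (by omega) (by omega)).trans hT)

variable [Algebra ℂ K]

/-- Blowups remove only closed points, so the generic point of a curve persists as that of its
strict transform. -/
theorem mem_blowupList_of_not_isClosedPoint {L : List (LocalSubring K)}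
    (hL : ∀ Q ∈ L, IsClosedPoint Q) (hS : ¬ IsClosedPoint S)
    (h : S ∈ X ∨ ∃ R ∈ L, S ∈ exceptionalFibre R) : S ∈ blowupList X L := by
  rcases h with h | ⟨R, hR, h⟩
  · exact mem_blowupList_of_notMem h fun h' => hS (hL _ h')
  · obtain ⟨L₁, L₂, rfl⟩ := List.append_of_mem hR
    exact mem_blowupList_append h fun h' => hS (hL _ (by simp [h']))

end Chain

/-! ### Transport of local rings by an automorphism -/

section Image

variable {K : Type*} [Field K] [Algebra ℂ K] (φ : K ≃ₐ[ℂ] K) {S T : LocalSubring K} {x : K}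

theorem mem_image_iff : x ∈ (image φ S).toSubring ↔ φ.symm x ∈ S.toSubring := by
  constructor
  · rintro ⟨y, hy, rfl⟩
    simpa using hy
  · exact fun h => ⟨φ.symm x, h, by simp⟩

theorem small_image_iff : Small (image φ S) x ↔ Small S (φ.symm x) := by
  -- Smallness is expressed by membership alone, and membership is visibly transported.
  have key : ∀ (R : LocalSubring K) (y : K),
      Small R y ↔ y ∈ R.toSubring ∧ (y = 0 ∨ y⁻¹ ∉ R.toSubring) := by
    intro R y
    constructor
    · intro h
      refine ⟨h.mem, or_iff_not_imp_left.2 fun h0 hi => not_small_of_inv_mem h0 hi h⟩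
    · rintro ⟨h, rfl | h'⟩
      · exact small_zero
      · exact (small_or_inv_mem h).resolve_right h'
  rw [key, key, mem_image_iff, mem_image_iff, map_inv₀, map_eq_zero_iff _ φ.symm.injective]

theorem image_mono (h : S ≤ T) : image φ S ≤ image φ T :=
  le_of_small (fun _ hx => (mem_image_iff φ).2 (mem_of_le h ((mem_image_iff φ).1 hx)))
    fun _ hx => (small_image_iff φ).2 (((small_image_iff φ).1 hx).of_le h)

theorem image_image_symm (S : LocalSubring K) : image φ (image φ.symm S) = S :=
  LocalSubring.toSubring_injective (SetLike.ext fun _ => by simp [mem_image_iff])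

theorem image_symm_image (S : LocalSubring K) : image φ.symm (image φ S) = S :=
  LocalSubring.toSubring_injective (SetLike.ext fun _ => by simp [mem_image_iff])

theorem image_le_iff : image φ S ≤ T ↔ S ≤ image φ.symm T :=
  ⟨fun h => image_symm_image φ S ▸ image_mono φ.symm h,
    fun h => image_image_symm φ T ▸ image_mono φ h⟩

variable {φ}

theorem ContainsConstants.image (h : ContainsConstants S) : ContainsConstants (image φ S) :=
  fun c => (mem_image_iff φ).2 (by simpa using h c)

theorem nonconstant_image_iff : Nonconstant (image φ S) x ↔ Nonconstant S (φ.symm x) := by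
  simp [Nonconstant, mem_image_iff, small_image_iff]

theorem Nonconstant.add_const (hT : ContainsConstants T) (h : Nonconstant T x) (c : ℂ) :
    Nonconstant T (x + algebraMap ℂ K c) := by
  refine ⟨add_mem h.1 (hT c), fun d hd => h.2 (d - c) ?_⟩
  rwa [map_sub, show x - (algebraMap ℂ K d - algebraMap ℂ K c) =
    x + algebraMap ℂ K c - algebraMap ℂ K d by ring]

end Image

/-! ### The coordinates `r_k`, `d_k`, `s` and the chain of centres -/

theorem isCoordinates_yP2_zP2 : IsCoordinates yP2 zP2 := by
  constructor
  · have h := (MvPolynomial.algebraicIndependent_X (Fin 2) ℂ).map'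
      (f := IsScalarTower.toAlgHom ℂ (MvPolynomial (Fin 2) ℂ) FunctionFieldP2)
      (IsFractionRing.injective (MvPolynomial (Fin 2) ℂ) FunctionFieldP2)
    have h' : ![yP2, zP2] = IsScalarTower.toAlgHom ℂ (MvPolynomial (Fin 2) ℂ) FunctionFieldP2 ∘
        MvPolynomial.X := by
      ext i
      fin_cases i <;> rfl
    rw [h']
    exact h
  · intro E hy hz
    have key : ∀ p : MvPolynomial (Fin 2) ℂ, algebraMap _ FunctionFieldP2 p ∈ E := by
      intro p
      induction p using MvPolynomial.induction_on with
      | C c => exact E.algebraMap_mem c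
      | add p q hp hq => rw [map_add]; exact E.add_mem hp hq
      | mul_X p i hp =>
        rw [map_mul]
        refine E.mul_mem hp ?_
        fin_cases i
        exacts [hy, hz]
    refine eq_top_iff.2 fun x _ => ?_
    obtain ⟨a, b, -, rfl⟩ := IsFractionRing.div_surjective (A := MvPolynomial (Fin 2) ℂ) x
    exact E.div_mem (key a) (key b)

theorem yP2_ne_zero : yP2 ≠ 0 := isCoordinates_yP2_zP2.left_ne_zero

theorem zP2_ne_zero : zP2 ≠ 0 := isCoordinates_yP2_zP2.right_ne_zero

theorem sCoord_ne_zero : sCoord ≠ 0 := div_ne_zero zP2_ne_zero yP2_ne_zero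

theorem sCoord_inv : sCoord⁻¹ = yP2 / zP2 := by rw [sCoord, inv_div]

theorem zP2_eq : zP2 = yP2 * sCoord := by
  have := yP2_ne_zero
  rw [sCoord]
  field_simp

theorem rCoord_eq (k : ℕ) : rCoord k = yP2 / sCoord ^ k := by
  have := yP2_ne_zero
  have := zP2_ne_zero
  rw [rCoord, sCoord, div_pow, pow_succ]
  field_simp

theorem rCoord_zero : rCoord 0 = yP2 := by simp [rCoord]

theorem rCoord_succ (k : ℕ) : rCoord (k + 1) = rCoord k / sCoord := by
  have := sCoord_ne_zero
  rw [rCoord_eq, rCoord_eq, pow_succ]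
  field_simp

theorem rCoord_add_mul (k j : ℕ) : rCoord (k + j) * sCoord ^ j = rCoord k := by
  have := sCoord_ne_zero
  rw [rCoord_eq, rCoord_eq, pow_add]
  field_simp

theorem isCoordinates_zP2_yP2 : IsCoordinates zP2 yP2 := isCoordinates_yP2_zP2.symm

theorem isCoordinates_rCoord (k : ℕ) : IsCoordinates (rCoord k) sCoord := by
  induction k with
  | zero =>
    rw [rCoord_zero]
    exact isCoordinates_zP2_yP2.div.symm
  | succ k ih =>
    rw [rCoord_succ]
    exact ih.div

/-- The coordinate `(r + ε) / s ^ k`, where `r = yⁿ / zⁿ⁻¹`. -/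
def dCoord (ε : ℂ) (n k : ℕ) : FunctionFieldP2 :=
  (rCoord (n - 1) + algebraMap ℂ FunctionFieldP2 ε) / sCoord ^ k

theorem dCoord_zero (ε : ℂ) (n : ℕ) :
    dCoord ε n 0 = rCoord (n - 1) + algebraMap ℂ FunctionFieldP2 ε := by
  simp [dCoord]

theorem dCoord_succ (ε : ℂ) (n k : ℕ) : dCoord ε n (k + 1) = dCoord ε n k / sCoord := by
  have := sCoord_ne_zero
  rw [dCoord, dCoord, pow_succ]
  field_simp

theorem isCoordinates_dCoord (ε : ℂ) (n k : ℕ) : IsCoordinates (dCoord ε n k) sCoord := by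
  induction k with
  | zero =>
    rw [dCoord_zero]
    exact (isCoordinates_rCoord _).add ε
  | succ k ih =>
    rw [dCoord_succ]
    exact ih.div

/-- The point `(0, 0)` of the chart with coordinates `(r + ε) / s ^ k` and `s`. -/
def pointD (ε : ℂ) (n k : ℕ) : LocalSubring FunctionFieldP2 := originAt (dCoord ε n k) sCoord

/-- The points `P, A₀, …, A_{n-2}` followed by the points `pointD ε n k`. -/
def chainPoint (ε : ℂ) (n i : ℕ) : LocalSubring FunctionFieldP2 :=
  if i = 0 then pointP else if i < n then pointA (i - 1) else pointD ε n (i - n)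

theorem chainPoint_zero (ε : ℂ) (n : ℕ) : chainPoint ε n 0 = pointP := rfl

theorem chainPoint_succ {ε : ℂ} {n k : ℕ} (h : k + 1 < n) :
    chainPoint ε n (k + 1) = pointA k := by
  simp [chainPoint, h]

theorem chainPoint_add {ε : ℂ} {n : ℕ} (hn : n ≠ 0) (k : ℕ) :
    chainPoint ε n (n + k) = pointD ε n k := by
  simp [chainPoint, hn]

/-- The list `P, A₀, …, A_{n-2}` followed by the points `pointD ε n k` with `k ≤ n - 2`. -/
def xiList (ε : ℂ) (n : ℕ) : List (LocalSubring FunctionFieldP2) :=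
  (List.range (2 * n - 1)).map (chainPoint ε n)

theorem xiList_eq {n : ℕ} (hn : n ≠ 0) (ε : ℂ) : xiList ε n =
    pointP :: ((List.range (n - 1)).map pointA ++ (List.range (n - 1)).map (pointD ε n)) := by
  have h : 2 * n - 1 = 1 + (n - 1) + (n - 1) := by omega
  rw [xiList, h, List.range_add, List.range_add, List.map_append, List.map_append]
  simp only [List.map_map, List.append_assoc]
  have h1 : (List.range (n - 1)).map (chainPoint ε n ∘ fun x => 1 + x) =
      (List.range (n - 1)).map pointA := by
    refine List.map_congr_left fun k hk => ?_
    rw [List.mem_range] at hk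
    simp only [Function.comp_apply]
    rw [add_comm, chainPoint_succ (by omega)]
  have h2 : (List.range (n - 1)).map (chainPoint ε n ∘ fun x => 1 + (n - 1) + x) =
      (List.range (n - 1)).map (pointD ε n) := by
    refine List.map_congr_left fun k _ => ?_
    simp only [Function.comp_apply]
    rw [show 1 + (n - 1) = n by omega, chainPoint_add hn]
  rw [h1, h2]
  rfl

theorem pointB_eq (n k : ℕ) : pointB n k = pointD 1 n k := by
  simp [pointB, pointD, dCoord]

theorem pointC_eq (n k : ℕ) : pointC n k = pointD (-1) n k := by
  simp [pointC, pointD, dCoord, sub_eq_add_neg]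

theorem xiOne_eq {n : ℕ} (hn : n ≠ 0) : xiOne n = xiList 1 n := by
  rw [xiList_eq hn, xiOne, funext (pointB_eq n)]

theorem xiTwo_eq {n : ℕ} (hn : n ≠ 0) : xiTwo n = xiList (-1) n := by
  rw [xiList_eq hn, xiTwo, funext (pointC_eq n)]

theorem pointP_eq : pointP = originAt zP2 yP2 := originAt_comm isCoordinates_yP2_zP2

theorem exists_isCoordinates_chainPoint (ε : ℂ) (n i : ℕ) :
    ∃ u v, IsCoordinates u v ∧ chainPoint ε n i = originAt u v := by
  unfold chainPoint
  split_ifs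
  exacts [⟨_, _, isCoordinates_yP2_zP2, rfl⟩, ⟨_, _, isCoordinates_rCoord _, rfl⟩,
    ⟨_, _, isCoordinates_dCoord _ _ _, rfl⟩]

/-- Each centre has direction `0` in the chart of its predecessor, except `pointD ε n 0`, which sits
at `r = -ε` on the last curve over the `A_k`. At `P` the coordinates are exchanged, since the ratio
wanted is `s = z / y`. -/
theorem chainPoint_succ_mem {ε : ℂ} {n : ℕ} (hn : 2 ≤ n) (i : ℕ) :
    chainPoint ε n (i + 1) ∈ exceptionalFibre (chainPoint ε n i) := by
  rcases Nat.lt_or_ge (i + 1) n with h | h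
  · rw [chainPoint_succ h]
    rcases i with _ | i
    · have h0 : IsCoordinates yP2 sCoord := rCoord_zero ▸ isCoordinates_rCoord 0
      rw [chainPoint_zero, pointP_eq, pointA, rCoord_zero, originAt_comm h0]
      simpa [sCoord] using originAt_mem_exceptionalFibre isCoordinates_zP2_yP2 0
    · rw [chainPoint_succ (by omega), pointA, pointA, rCoord_succ]
      simpa using originAt_mem_exceptionalFibre (isCoordinates_rCoord i) 0
  · obtain ⟨k, hk⟩ := Nat.exists_eq_add_of_le h
    rw [hk, chainPoint_add (by omega)]
    rcases k with _ | k
    · obtain ⟨m, rfl⟩ : ∃ m, n = m + 2 := ⟨n - 2, by omega⟩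
      obtain rfl : i = m + 1 := by omega
      rw [chainPoint_succ (by omega), pointD, pointA, dCoord_zero,
        show m + 2 - 1 = m + 1 by omega, rCoord_succ]
      simpa using originAt_mem_exceptionalFibre (isCoordinates_rCoord m) (-ε)
    · obtain rfl : i = n + k := by omega
      rw [chainPoint_add (by omega), pointD, pointD, dCoord_succ]
      simpa using originAt_mem_exceptionalFibre (isCoordinates_dCoord ε n k) 0

theorem isClosedPoint_of_mem_xiList {ε : ℂ} {n : ℕ} {R : LocalSubring FunctionFieldP2}
    (hR : R ∈ xiList ε n) : IsClosedPoint R := by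
  obtain ⟨i, -, rfl⟩ := List.mem_map.1 hR
  obtain ⟨u, v, h, he⟩ := exists_isCoordinates_chainPoint ε n i
  rw [he]
  exact isClosedPoint_originAt h

/-! ### The projective plane as a separated model -/

theorem homCoord_ne_zero (i : Fin 3) : homCoord i ≠ 0 := by
  fin_cases i
  exacts [one_ne_zero, yP2_ne_zero, zP2_ne_zero]

/-- The coordinate ring of the chart `xᵢ ≠ 0` of the plane. -/
def planeChart (i : Fin 3) : Subring FunctionFieldP2 :=
  (Algebra.adjoin ℂ (Set.range fun j : Fin 3 => homCoord j / homCoord i)).toSubring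

theorem mem_planeP2_iff {R : LocalSubring FunctionFieldP2} :
    R ∈ planeP2 ↔ ∃ i, IsLocalizationOf (planeChart i) R := by
  simp only [planeP2, Set.mem_iUnion, mem_affineModel_iff, planeChart]

theorem div_mem_planeChart (i j : Fin 3) : homCoord j / homCoord i ∈ planeChart i :=
  Algebra.subset_adjoin ⟨j, rfl⟩

theorem algebraMap_mem_planeChart (i : Fin 3) (c : ℂ) :
    algebraMap ℂ FunctionFieldP2 c ∈ planeChart i :=
  Subalgebra.algebraMap_mem _ c

theorem planeChart_le {R : LocalSubring FunctionFieldP2} (hR : ContainsConstants R) {i : Fin 3}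
    (h : ∀ j, homCoord j / homCoord i ∈ R.toSubring) : planeChart i ≤ R.toSubring :=
  hR.adjoin_le (by rintro _ ⟨j, rfl⟩; exact h j)

theorem isSeparatedModel_planeP2 : IsSeparatedModel planeP2 := by
  have aux : ∀ {R S T : LocalSubring FunctionFieldP2} {i j : Fin 3},
      IsLocalizationOf (planeChart i) R → IsLocalizationOf (planeChart j) S → R ≤ T → S ≤ T →
      planeChart j ≤ R.toSubring := by
    intro R S T i j hR hS hRT hST
    have hi := homCoord_ne_zero i
    have hj := homCoord_ne_zero j
    have h1 : homCoord i / homCoord j ∈ R.toSubring := by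
      rw [← inv_div]
      refine inv_mem_of_le hRT (hR.1 (div_mem_planeChart i j)) (div_ne_zero hj hi) ?_
      rw [inv_div]
      exact mem_of_le hST (hS.1 (div_mem_planeChart j i))
    refine planeChart_le (fun c => hR.1 (algebraMap_mem_planeChart i c)) fun k => ?_
    rw [show homCoord k / homCoord j = homCoord k / homCoord i * (homCoord i / homCoord j) by
      field_simp]
    exact mul_mem (hR.1 (div_mem_planeChart i k)) h1
  intro R hR S hS T hRT hST
  obtain ⟨i, hR⟩ := mem_planeP2_iff.1 hR
  obtain ⟨j, hS⟩ := mem_planeP2_iff.1 hS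
  exact hR.eq hS (aux hS hR hST hRT) (aux hR hS hRT hST) hRT hST

theorem containsConstants_of_mem_planeP2 {R : LocalSubring FunctionFieldP2}
    (hR : R ∈ planeP2) : ContainsConstants R := by
  obtain ⟨i, hR⟩ := mem_planeP2_iff.1 hR
  exact fun c => hR.1 (algebraMap_mem_planeChart i c)

theorem mem_planeP2_of_isLocalizationOf {R : LocalSubring FunctionFieldP2}
    (hR : IsLocalizationOf (coordRing yP2 zP2) R) : R ∈ planeP2 := by
  refine mem_planeP2_iff.2 ⟨0, ?_⟩
  have h : planeChart 0 = coordRing yP2 zP2 := by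
    unfold planeChart coordRing
    congr 1
    refine le_antisymm (Algebra.adjoin_le ?_) (Algebra.adjoin_mono ?_)
    · rintro _ ⟨j, rfl⟩
      fin_cases j
      · simp [homCoord]
      · simpa [homCoord] using Algebra.subset_adjoin (by simp)
      · simpa [homCoord] using Algebra.subset_adjoin (by simp)
    · rintro _ (rfl | rfl)
      · exact ⟨1, by simp [homCoord]⟩
      · exact ⟨2, by simp [homCoord]⟩
  rwa [h]

theorem pointP_mem_planeP2 : pointP ∈ planeP2 :=
  mem_planeP2_of_isLocalizationOf (isLocalizationOf_originAt isCoordinates_yP2_zP2)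

theorem lineDelta_eq_curveAt : lineDelta = curveAt yP2 zP2 := rfl

theorem lineDelta_mem_planeP2 : lineDelta ∈ planeP2 :=
  mem_planeP2_of_isLocalizationOf (isLocalizationOf_curveAt isCoordinates_yP2_zP2)

theorem areSuccessiveCentres_xiList {n : ℕ} (hn : 2 ≤ n) (ε : ℂ) :
    AreSuccessiveCentres planeP2 (xiList ε n) ∧
      (xiList ε n).IsChain fun p q => q ∈ exceptionalFibre p := by
  have hc : (xiList ε n).IsChain fun p q => q ∈ exceptionalFibre p := by
    rw [xiList, List.isChain_map, List.isChain_range]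
    exact fun i _ => chainPoint_succ_mem hn i
  refine ⟨?_, hc⟩
  have hm := @isClosedPoint_of_mem_xiList ε n
  rw [xiList_eq (by omega)] at hc hm ⊢
  exact areSuccessiveCentres_of_isChain pointP_mem_planeP2 (fun _ => hm) hc

theorem isInfinitelyNear_xiList {n : ℕ} (hn : 2 ≤ n) (ε : ℂ) :
    IsInfinitelyNear planeP2 pointP (2 * n - 1) (xiList ε n) := by
  refine ⟨by simp [xiList], ?_, areSuccessiveCentres_xiList hn ε⟩
  rw [xiList_eq (by omega)]
  rfl

/-! ### Strata of the blown up surface -/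

section

variable {R S T : LocalSubring FunctionFieldP2} {ε : ℂ} {n : ℕ}

/-- Where a local ring is centred on the surface obtained by blowing up `xiList ε n`: on the plane
away from `P`, on the exceptional curve of `P`, on that of one of the `A_k`, or on that of one of
the points `pointD ε n k`, outside the next centre in each case. -/
inductive Located (ε : ℂ) (n : ℕ) (T : LocalSubring FunctionFieldP2) : Prop
  | chartZ (h₁ : zP2⁻¹ ∈ T.toSubring) (h₂ : sCoord⁻¹ ∈ T.toSubring)
  | chartY (h₁ : yP2⁻¹ ∈ T.toSubring) (h₂ : sCoord ∈ T.toSubring)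
  | overP (h₁ : Small T yP2) (h₂ : Small T zP2) (h₃ : sCoord⁻¹ ∈ T.toSubring)
  | overA (k : ℕ) (hk : k + 3 ≤ n) (h₁ : Small T (rCoord k)) (h₂ : Small T sCoord)
      (h₃ : (rCoord (k + 1))⁻¹ ∈ T.toSubring)
  | overLastA (h₁ : Small T (rCoord (n - 2))) (h₂ : Small T sCoord)
      (h₃ : rCoord (n - 1) ∈ T.toSubring ∨ (rCoord (n - 1))⁻¹ ∈ T.toSubring)
      (h₄ : ¬ Small T (dCoord ε n 0))
  | overD (k : ℕ) (hk : k + 3 ≤ n) (h₁ : Small T (dCoord ε n k)) (h₂ : Small T sCoord)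
      (h₃ : (dCoord ε n (k + 1))⁻¹ ∈ T.toSubring)
  | overLastD (h₁ : Small T (dCoord ε n (n - 2))) (h₂ : Small T sCoord)
      (h₃ : dCoord ε n (n - 1) ∈ T.toSubring ∨ (dCoord ε n (n - 1))⁻¹ ∈ T.toSubring)

theorem rCoord_ne_zero (k : ℕ) : rCoord k ≠ 0 := (isCoordinates_rCoord k).left_ne_zero

theorem dCoord_ne_zero (ε : ℂ) (n k : ℕ) : dCoord ε n k ≠ 0 :=
  (isCoordinates_dCoord ε n k).left_ne_zero

theorem containsConstants_of_mem_blowupList (hn : 2 ≤ n)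
    (hR : R ∈ blowupList planeP2 (xiList ε n)) : ContainsConstants R := by
  obtain ⟨S, hS, hSR⟩ :=
    (areSuccessiveCentres_xiList hn ε).1.isIteratedBlowup.exists_le hR
  exact (containsConstants_of_mem_planeP2 hS).of_le hSR

theorem exists_le_of_chainPoint (hn : 2 ≤ n) {i : ℕ} (hi : i < 2 * n - 1) {u v : FunctionFieldP2}
    (h : IsCoordinates u v) (hp : chainPoint ε n i = originAt u v) (hT : ContainsConstants T)
    (hu : Small T u) (hv : Small T v) (huv : u / v ∈ T.toSubring ∨ (u / v)⁻¹ ∈ T.toSubring)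
    (hi' : i + 1 < 2 * n - 1 → ¬ chainPoint ε n (i + 1) ≤ T) :
    ∃ S ∈ blowupList planeP2 (xiList ε n), S ≤ T := by
  rw [inv_div] at huv
  obtain ⟨S, hS, hST⟩ := exists_mem_exceptionalFibre_le h (originAt_le h hT hu hv) huv
  rw [← hp] at hS
  exact ⟨S, mem_blowupList_chain_of_mem_exceptionalFibre (fun i _ => chainPoint_succ_mem hn i)
    hi hS hST hi', hST⟩

theorem exists_le_of_planeChart (hn : 2 ≤ n) {i : Fin 3} (hT : ContainsConstants T)
    (h : ∀ j, homCoord j / homCoord i ∈ T.toSubring) (h0 : ¬ pointP ≤ T) :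
    ∃ S ∈ blowupList planeP2 (xiList ε n), S ≤ T := by
  obtain ⟨S, hS, hST⟩ := exists_mem_affineModel_le (planeChart_le hT h)
  refine ⟨S, mem_blowupList_chain_of_mem (fun i _ => chainPoint_succ_mem hn i) ?_ hST h0, hST⟩
  exact mem_planeP2_iff.2 ⟨i, mem_affineModel_iff.1 hS⟩

/-- In each stratum the regular ratio places `T` over the right centre or plane chart. The regular
inverse, or `h₄` in the case of the last `A_k`, keeps it off the next centre; over the last centre
there is none to avoid. -/
theorem Located.exists_le (hn : 3 ≤ n) (hT : ContainsConstants T) (h : Located ε n T) :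
    ∃ S ∈ blowupList planeP2 (xiList ε n), S ≤ T := by
  have hs0 := sCoord_ne_zero
  have hy0 := yP2_ne_zero
  have hz0 := zP2_ne_zero
  cases h with
  | chartZ h₁ h₂ =>
    refine exists_le_of_planeChart (i := 2) (by omega) hT (fun j => ?_) fun h =>
      not_small_of_inv_mem hz0 h₁ ((small_originAt_right isCoordinates_yP2_zP2).of_le h)
    rw [sCoord_inv] at h₂
    fin_cases j
    · simpa [homCoord] using h₁
    · exact h₂
    · simp [homCoord, hz0]
  | chartY h₁ h₂ =>
    refine exists_le_of_planeChart (i := 1) (by omega) hT (fun j => ?_) fun h =>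
      not_small_of_inv_mem hy0 h₁ ((small_originAt_left isCoordinates_yP2_zP2).of_le h)
    fin_cases j
    · simpa [homCoord] using h₁
    · simp [homCoord, hy0]
    · exact h₂
  | overP h₁ h₂ h₃ =>
    refine exists_le_of_chainPoint (by omega) (i := 0) (by omega) isCoordinates_yP2_zP2 rfl hT
      h₁ h₂ (Or.inl (by rwa [← sCoord_inv])) fun _ h => ?_
    rw [chainPoint_succ (by omega)] at h
    exact not_small_of_inv_mem hs0 h₃ ((small_originAt_right (isCoordinates_rCoord 0)).of_le h)
  | overA k hk h₁ h₂ h₃ =>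
    refine exists_le_of_chainPoint (by omega) (i := k + 1) (by omega) (isCoordinates_rCoord k)
      (chainPoint_succ (by omega)) hT h₁ h₂ (Or.inr (by rwa [← rCoord_succ])) fun _ h => ?_
    rw [chainPoint_succ (by omega)] at h
    exact not_small_of_inv_mem (rCoord_ne_zero _) h₃
      ((small_originAt_left (isCoordinates_rCoord (k + 1))).of_le h)
  | overLastA h₁ h₂ h₃ h₄ =>
    obtain ⟨m, rfl⟩ : ∃ m, n = m + 2 := ⟨n - 2, by omega⟩
    rw [show m + 2 - 1 = m + 1 by omega, rCoord_succ] at h₃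
    refine exists_le_of_chainPoint (by omega) (i := m + 1) (by omega) (isCoordinates_rCoord m)
      (chainPoint_succ (by omega)) hT h₁ h₂ h₃ fun _ h => ?_
    rw [show m + 1 + 1 = m + 2 + 0 by omega, chainPoint_add (by omega)] at h
    exact h₄ ((small_originAt_left (isCoordinates_dCoord ε (m + 2) 0)).of_le h)
  | overD k hk h₁ h₂ h₃ =>
    refine exists_le_of_chainPoint (by omega) (i := n + k) (by omega)
      (isCoordinates_dCoord ε n k) (chainPoint_add (by omega) k) hT h₁ h₂
      (Or.inr (by rwa [← dCoord_succ])) fun _ h => ?_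
    rw [add_assoc, chainPoint_add (by omega)] at h
    exact not_small_of_inv_mem (dCoord_ne_zero _ _ _) h₃
      ((small_originAt_left (isCoordinates_dCoord ε n (k + 1))).of_le h)
  | overLastD h₁ h₂ h₃ =>
    refine exists_le_of_chainPoint (by omega) (i := n + (n - 2)) (by omega)
      (isCoordinates_dCoord ε n (n - 2)) (chainPoint_add (by omega) _) hT h₁ h₂ ?_ (by omega)
    rwa [← dCoord_succ, show n - 2 + 1 = n - 1 by omega]

theorem located_of_mem_planeP2 (hR : R ∈ planeP2) (h : ¬ pointP ≤ R) : Located ε n R := by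
  have hC := containsConstants_of_mem_planeP2 hR
  obtain ⟨i, hi⟩ := mem_planeP2_iff.1 hR
  have hj := fun j => hi.1 (div_mem_planeChart i j)
  have hz := zP2_ne_zero
  fin_cases i
  · have hy : yP2 ∈ R.toSubring := by simpa [homCoord] using hj 1
    have hz : zP2 ∈ R.toSubring := by simpa [homCoord] using hj 2
    rcases small_or_inv_mem hy with h1 | h1
    · rcases small_or_inv_mem hz with h2 | h2
      · exact (h (originAt_le isCoordinates_yP2_zP2 hC h1 h2)).elim
      · exact .chartZ h2 (by rw [sCoord_inv]; exact mul_mem_of_inv hy h2)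
    · exact .chartY h1 (mul_mem_of_inv hz h1)
  · exact .chartY (by simpa [homCoord] using hj 0) (hj 2)
  · exact .chartZ (by simpa [homCoord] using hj 0) (by rw [sCoord_inv]; exact hj 1)

/-- If `u / v` were small, then, `v` being small as well, `R` would dominate the origin of the next
chart. -/
theorem inv_div_mem_of_exceptionalFibre {u v : FunctionFieldP2} (h : IsCoordinates u v)
    (hR : R ∈ exceptionalFibre (originAt u v))
    (h' : ¬ originAt (u / v) v ≤ R) : (u / v)⁻¹ ∈ R.toSubring := by
  have hC := (containsConstants_originAt h).of_le hR.1
  rcases div_mem_or_of_mem_exceptionalFibre h hR with h1 | h1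
  · refine inv_mem_of_not_small h1 fun h2 => h' ?_
    exact originAt_le h.div hC h2 ((small_originAt_right h).of_le hR.1)
  · rwa [inv_div]

theorem located_of_mem_blowupList (hn : 3 ≤ n) (hR : R ∈ blowupList planeP2 (xiList ε n)) :
    Located ε n R := by
  have hC := containsConstants_of_mem_blowupList (by omega) hR
  rcases of_mem_blowupList_chain isSeparatedModel_planeP2 pointP_mem_planeP2
    (fun i _ => chainPoint_succ_mem (by omega) i) hR with ⟨h, h'⟩ | ⟨i, hi, h, h'⟩
  · exact located_of_mem_planeP2 h (h' (by omega))
  rcases i with _ | k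
  · have hP := isCoordinates_yP2_zP2
    have hA : IsCoordinates yP2 sCoord := rCoord_zero ▸ isCoordinates_rCoord 0
    refine .overP ((small_originAt_left hP).of_le h.1) ((small_originAt_right hP).of_le h.1) ?_
    rw [chainPoint_zero, pointP_eq] at h
    refine inv_div_mem_of_exceptionalFibre hP.symm h fun hle => h' (by omega) ?_
    rw [chainPoint_succ (by omega), pointA, rCoord_zero, originAt_comm hA]
    exact hle
  · rcases Nat.lt_trichotomy (k + 2) n with hk | rfl | hk
    · have hA := isCoordinates_rCoord k
      have h'' := h' (by omega)
      rw [chainPoint_succ (by omega), pointA, rCoord_succ] at h''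
      rw [chainPoint_succ (by omega)] at h
      refine .overA k (by omega) ((small_originAt_left hA).of_le h.1)
        ((small_originAt_right hA).of_le h.1) ?_
      rw [rCoord_succ]
      exact inv_div_mem_of_exceptionalFibre hA h h''
    · have hA := isCoordinates_rCoord k
      have h'' := h' (by omega)
      rw [show k + 1 + 1 = k + 2 + 0 by omega, chainPoint_add (by omega)] at h''
      rw [chainPoint_succ (by omega)] at h
      have hs := (small_originAt_right hA).of_le h.1
      refine .overLastA ((small_originAt_left hA).of_le h.1) hs ?_ fun h1 => h'' ?_
      · rw [show k + 2 - 1 = k + 1 by omega, rCoord_succ, inv_div]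
        exact div_mem_or_of_mem_exceptionalFibre hA h
      · exact originAt_le (isCoordinates_dCoord ε (k + 2) 0) hC h1 hs
    · obtain ⟨j, hj⟩ : ∃ j, k + 1 = n + j := ⟨k + 1 - n, by omega⟩
      have hD := isCoordinates_dCoord ε n j
      rw [hj] at h h'
      rw [chainPoint_add (by omega)] at h
      have hs := (small_originAt_right hD).of_le h.1
      rcases Nat.lt_or_ge (j + 2) n with hj' | hj'
      · have h'' := h' (by omega)
        rw [add_assoc, chainPoint_add (by omega), pointD, dCoord_succ] at h''
        refine .overD j (by omega) ((small_originAt_left hD).of_le h.1) hs ?_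
        rw [dCoord_succ]
        exact inv_div_mem_of_exceptionalFibre hD h h''
      · obtain rfl : n = j + 2 := by omega
        refine .overLastD ((small_originAt_left hD).of_le h.1) hs ?_
        rw [show j + 2 - 1 = j + 1 by omega, dCoord_succ, inv_div]
        exact div_mem_or_of_mem_exceptionalFibre hD h

end

/-! ### Shears and their action on the strata -/

section

variable {R S T : LocalSubring FunctionFieldP2} {ε : ℂ} {n : ℕ}
  {φ : FunctionFieldP2 ≃ₐ[ℂ] FunctionFieldP2}

/-- `φ` fixes `s = z / y` and maps `r = yⁿ / zⁿ⁻¹` to `ε r / (r + ε)`. In the affine coordinates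
`x / z` and `y / z` this is the shear `(x, y) ↦ (x + ε yⁿ, y)` when `ε = ±1`. -/
def IsShear (ε : ℂ) (n : ℕ) (φ : FunctionFieldP2 ≃ₐ[ℂ] FunctionFieldP2) : Prop :=
  φ sCoord = sCoord ∧ φ (rCoord (n - 1)) =
    algebraMap ℂ FunctionFieldP2 ε * rCoord (n - 1) / dCoord ε n 0

theorem algebraMap_sq (hε : ε ^ 2 = 1) :
    algebraMap ℂ FunctionFieldP2 ε * algebraMap ℂ FunctionFieldP2 ε = 1 := by
  rw [← map_mul, ← sq, hε, map_one]

theorem algebraMap_ne_zero (hε : ε ^ 2 = 1) : algebraMap ℂ FunctionFieldP2 ε ≠ 0 := fun h => by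
  simpa [h] using algebraMap_sq hε

theorem rCoord_last (ε : ℂ) (n : ℕ) :
    rCoord (n - 1) = dCoord ε n 0 - algebraMap ℂ FunctionFieldP2 ε := by
  rw [dCoord_zero]; ring

theorem dCoord_add_mul (ε : ℂ) (n k j : ℕ) :
    dCoord ε n (k + j) * sCoord ^ j = dCoord ε n k := by
  have := sCoord_ne_zero
  rw [dCoord, dCoord, pow_add]
  field_simp

theorem IsShear.map_rCoord (h : IsShear ε n φ) {k : ℕ} (hk : k < n) : φ (rCoord k) =
    algebraMap ℂ FunctionFieldP2 ε * rCoord k / dCoord ε n 0 := by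
  have h1 := rCoord_add_mul k (n - 1 - k)
  rw [show k + (n - 1 - k) = n - 1 by omega] at h1
  rw [← h1, map_mul, map_pow, h.1, h.2]
  ring

theorem IsShear.map_yP2 (h : IsShear ε n φ) (hn : 0 < n) : φ yP2 =
    algebraMap ℂ FunctionFieldP2 ε * yP2 / dCoord ε n 0 := by
  simpa [rCoord_zero] using h.map_rCoord hn

theorem IsShear.map_zP2 (h : IsShear ε n φ) (hn : 0 < n) : φ zP2 =
    algebraMap ℂ FunctionFieldP2 ε * zP2 / dCoord ε n 0 := by
  rw [zP2_eq, map_mul, h.1, h.map_yP2 hn]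
  ring

/-- This is `ε r / (r + ε) - ε = -ε² / (r + ε)`; here `ε² = 1` enters. -/
theorem IsShear.map_dCoord_zero (hε : ε ^ 2 = 1) (h : IsShear ε n φ) :
    φ (dCoord (-ε) n 0) = -(dCoord ε n 0)⁻¹ := by
  have hd := dCoord_ne_zero ε n 0
  rw [dCoord_zero (-ε), map_add, h.2, AlgEquiv.commutes, map_neg, rCoord_last ε n]
  field_simp
  linear_combination -algebraMap_sq hε

theorem IsShear.map_dCoord (hε : ε ^ 2 = 1) (h : IsShear ε n φ) (k : ℕ) :
    φ (dCoord (-ε) n k) = -(dCoord ε n 0 * sCoord ^ k)⁻¹ := by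
  have h1 : dCoord (-ε) n k = dCoord (-ε) n 0 / sCoord ^ k := by simp [dCoord]
  rw [h1, map_div₀, map_pow, h.1, h.map_dCoord_zero hε]
  ring

/-- The sign symmetry that lets every later statement be applied to the inverse map as well. -/
theorem IsShear.symm (hε : ε ^ 2 = 1) (h : IsShear ε n φ) : IsShear (-ε) n φ.symm := by
  have hs : φ.symm sCoord = sCoord := by rw [AlgEquiv.symm_apply_eq, h.1]
  refine ⟨hs, ?_⟩
  have hd := dCoord_ne_zero ε n 0
  rw [AlgEquiv.symm_apply_eq, map_div₀, map_mul, AlgEquiv.commutes, h.2, h.map_dCoord_zero hε,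
    map_neg]
  field_simp
  linear_combination -rCoord (n - 1) * algebraMap_sq hε

theorem inv_neg_functionField (x : FunctionFieldP2) : (-x)⁻¹ = -x⁻¹ := by
  exact inv_neg

theorem inv_one_add_mem {R : LocalSubring FunctionFieldP2} {x : FunctionFieldP2}
    (hx : Small R x) : (1 + x)⁻¹ ∈ R.toSubring :=
  inv_mem_of_not_small (add_mem (one_mem _) hx.mem) fun h =>
    not_small_one (R := R) (by simpa using h.sub hx)

theorem one_add_ne_zero_of_small {R : LocalSubring FunctionFieldP2} {x : FunctionFieldP2}
    (hx : Small R x) : 1 + x ≠ 0 :=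
  ne_zero_of_not_small (R := R) fun h => not_small_one (R := R) (by simpa using h.sub hx)

theorem inv_const_add_mem (hR : ContainsConstants R) (hε : ε ≠ 0) {x : FunctionFieldP2}
    (hx : Small R x) : (x + algebraMap ℂ FunctionFieldP2 ε)⁻¹ ∈ R.toSubring :=
  inv_mem_of_not_small (add_mem hx.mem (hR _)) fun h =>
    hε (hR.eq_zero_of_small (by simpa using h.sub hx))

/-- The lift of a shear to the blowups is defined everywhere. -/
theorem Located.image_symm (hn : 3 ≤ n) (hε : ε ^ 2 = 1) (hφ : IsShear ε n φ)
    (hR : ContainsConstants R) (h : Located ε n R) : Located (-ε) n (image φ.symm R) := by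
  have hε0 : ε ≠ 0 := by rintro rfl; simp at hε
  have he := algebraMap_ne_zero hε
  have hee := algebraMap_sq hε
  have hs0 := sCoord_ne_zero
  have hy0 := yP2_ne_zero
  have hz0 := zP2_ne_zero
  have hd0 := dCoord_ne_zero ε n 0
  have hm : ∀ {x}, φ x ∈ R.toSubring → x ∈ (image φ.symm R).toSubring := fun hx =>
    (mem_image_iff _).2 hx
  have hsm : ∀ {x}, Small R (φ x) → Small (image φ.symm R) x := fun hx =>
    (small_image_iff _).2 hx
  have hns : ∀ {x}, ¬ Small R (φ x) → ¬ Small (image φ.symm R) x := fun hx h =>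
    hx ((small_image_iff _).1 h)
  have hy := hφ.map_yP2 (by omega)
  have hz := hφ.map_zP2 (by omega)
  have hs := hφ.1
  have hd := hφ.map_dCoord hε
  have hr := fun {k} => hφ.map_rCoord (k := k)
  have chartZ : zP2⁻¹ ∈ R.toSubring → sCoord⁻¹ ∈ R.toSubring →
      Located (-ε) n (image φ.symm R) := by
    intro h₁ h₂
    refine .chartZ (hm ?_) (hm (by rwa [map_inv₀, hs]))
    -- As `ε² = 1`, this says that `1 / z` goes to `1 / z + ε (y / z) ^ n`: the polynomial shear on
    -- the chart `z ≠ 0`.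
    have h3 : φ zP2⁻¹ = algebraMap ℂ FunctionFieldP2 ε *
        (sCoord⁻¹ ^ n + algebraMap ℂ FunctionFieldP2 ε * zP2⁻¹) := by
      obtain ⟨m, rfl⟩ : ∃ m, n = m + 1 := ⟨n - 1, by omega⟩
      rw [map_inv₀, hz, inv_div, dCoord_zero, Nat.add_sub_cancel, rCoord_eq, zP2_eq, pow_succ,
        inv_pow]
      rw [show algebraMap ℂ FunctionFieldP2 ε * ((sCoord ^ m)⁻¹ * sCoord⁻¹ +
        algebraMap ℂ FunctionFieldP2 ε * (yP2 * sCoord)⁻¹) =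
        algebraMap ℂ FunctionFieldP2 ε * ((sCoord ^ m)⁻¹ * sCoord⁻¹) +
        (algebraMap ℂ FunctionFieldP2 ε * algebraMap ℂ FunctionFieldP2 ε) *
          (yP2 * sCoord)⁻¹ by ring, hee]
      field_simp
      linear_combination -yP2 * hee
    rw [h3]
    exact mul_mem (hR _) (add_mem (pow_mem h₂ n) (mul_mem (hR _) h₁))
  cases h with
  | chartZ h₁ h₂ => exact chartZ h₁ h₂
  | chartY h₁ h₂ =>
    rcases small_or_inv_mem h₂ with h3 | h3
    -- On `Δ` away from `P`: `d_0 s ^ (n - 1) = y + ε s ^ (n - 1)` is `y` times a unit, so the last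
    -- `D`-coordinate has a regular pullback and the image lies over the last centre.
    · have h4 : Small R (algebraMap ℂ FunctionFieldP2 ε * sCoord ^ (n - 1) * yP2⁻¹) :=
        ((h3.pow (by omega)).mul_left (hR ε)).mul_right h₁
      have h5 := one_add_ne_zero_of_small h4
      have h6 : φ (dCoord (-ε) n (n - 1)) =
          -(yP2⁻¹ * (1 + algebraMap ℂ FunctionFieldP2 ε * sCoord ^ (n - 1) * yP2⁻¹)⁻¹) := by
        rw [hd, ← mul_inv, dCoord_zero, rCoord_eq]
        congr 2
        field_simp
      have h7 : φ (dCoord (-ε) n (n - 1)) ∈ R.toSubring := by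
        rw [h6]
        exact neg_mem (mul_mem h₁ (inv_one_add_mem h4))
      refine .overLastD (hsm ?_) (hsm (by rwa [hs])) (Or.inl (hm h7))
      rw [← dCoord_add_mul (-ε) n (n - 2) 1, map_mul, pow_one, hs,
        show n - 2 + 1 = n - 1 by omega]
      exact h3.mul_left h7
    · refine chartZ ?_ h3
      rw [zP2_eq, mul_inv]
      exact mul_mem h₁ h3
  | overP h₁ h₂ h₃ =>
    have h4 : rCoord (n - 1) = zP2 * sCoord⁻¹ ^ n := by
      obtain ⟨m, rfl⟩ : ∃ m, n = m + 1 := ⟨n - 1, by omega⟩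
      rw [Nat.add_sub_cancel, rCoord_eq, zP2_eq, pow_succ, inv_pow]
      field_simp
    -- Near `E` the function `r` vanishes, so `d_0 = r + ε` is a unit and the stratum is preserved.
    have h5 : Small R (rCoord (n - 1)) := h4 ▸ h₂.mul_right (pow_mem h₃ n)
    have h6 : (dCoord ε n 0)⁻¹ ∈ R.toSubring := by
      rw [dCoord_zero]
      exact inv_const_add_mem hR hε0 h5
    refine .overP (hsm ?_) (hsm ?_) (hm (by rwa [map_inv₀, hs]))
    · rw [hy, div_eq_mul_inv]
      exact (h₁.mul_left (hR ε)).mul_right h6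
    · rw [hz, div_eq_mul_inv]
      exact (h₂.mul_left (hR ε)).mul_right h6
  | overA k hk h₁ h₂ h₃ =>
    obtain ⟨j, rfl⟩ : ∃ j, n = k + j + 3 := ⟨n - k - 3, by omega⟩
    have hp0 := rCoord_ne_zero (k + 1)
    have h4 : rCoord (k + j + 3 - 1) * sCoord ^ (j + 1) = rCoord (k + 1) := by
      rw [show k + j + 3 - 1 = k + 1 + (j + 1) by omega, rCoord_add_mul]
    have h5 : Small R (algebraMap ℂ FunctionFieldP2 ε * sCoord ^ (j + 1) *
        (rCoord (k + 1))⁻¹) :=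
      ((h₂.pow (by omega)).mul_left (hR ε)).mul_right h₃
    set e := 1 + algebraMap ℂ FunctionFieldP2 ε * sCoord ^ (j + 1) * (rCoord (k + 1))⁻¹ with hedef
    have he0 : e ≠ 0 := one_add_ne_zero_of_small h5
    have hei : e⁻¹ ∈ R.toSubring := inv_one_add_mem h5
    have hem : e ∈ R.toSubring := add_mem (one_mem _) h5.mem
    have h6 : dCoord ε (k + j + 3) 0 * sCoord ^ (j + 1) = rCoord (k + 1) * e := by
      rw [dCoord_zero, add_mul, h4, hedef]
      field_simp
    have h7 : φ (dCoord (-ε) (k + j + 3) (j + 1)) = -((rCoord (k + 1))⁻¹ * e⁻¹) := by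
      rw [hd, h6, mul_inv]
    -- If `1 / r_{k+1}` vanishes, the centre is on the preceding curve too (`Δ` when `k = 0`), and
    -- the image lies over `D_{j+1}`. Otherwise `r_{k+1}` is regular and the image lies over `D_j`.
    rcases small_or_inv_mem h₃ with h8 | h8
    · have h9 : Small R (φ (dCoord (-ε) (k + j + 3) (j + 1))) := by
        rw [h7]
        exact (h8.mul_right hei).neg
      have h10 : φ (dCoord (-ε) (k + j + 3) (j + 1 + 1))⁻¹ = -(rCoord k * e) := by
        rw [map_inv₀, dCoord_succ, map_div₀, h7, hs, rCoord_succ]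
        have := rCoord_ne_zero k
        field_simp
      have h11 : φ (dCoord (-ε) (k + j + 3) (j + 1 + 1))⁻¹ ∈ R.toSubring := by
        rw [h10]
        exact neg_mem (mul_mem h₁.mem hem)
      rcases Nat.eq_zero_or_pos k with rfl | hk0
      · refine .overLastD (hsm ?_) (hsm (by rwa [hs])) (Or.inr (hm ?_))
        · rwa [show 0 + j + 3 - 2 = j + 1 by omega]
        · rwa [show 0 + j + 3 - 1 = j + 1 + 1 by omega]
      · exact .overD (j + 1) (by omega) (hsm h9) (hsm (by rwa [hs])) (hm h11)
    · rw [inv_inv] at h8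
      refine .overD j (by omega) (hsm ?_) (hsm (by rwa [hs])) (hm ?_)
      · rw [← dCoord_add_mul (-ε) (k + j + 3) j 1, map_mul, pow_one, hs, h7]
        exact h₂.mul_left (neg_mem (mul_mem h₃ hei))
      · rw [map_inv₀, h7, inv_neg_functionField, mul_inv, inv_inv, inv_inv]
        exact neg_mem (mul_mem h8 hem)
  | overLastA h₁ h₂ h₃ h₄ =>
    -- Where `r` is finite the image stays over the last `A_k`; at the pole of `r` it moves over
    -- `D_0`.
    by_cases h5 : rCoord (n - 1) ∈ R.toSubring
    · have h6 : dCoord ε n 0 ∈ R.toSubring := by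
        rw [dCoord_zero]
        exact add_mem h5 (hR ε)
      have h7 := inv_mem_of_not_small h6 h₄
      refine .overLastA (hsm ?_) (hsm (by rwa [hs])) (Or.inl (hm ?_)) (hns ?_)
      · rw [hr (by omega), div_eq_mul_inv]
        exact (h₁.mul_left (hR ε)).mul_right h7
      · rw [hφ.2, div_eq_mul_inv]
        exact mul_mem (mul_mem (hR ε) h5) h7
      · rw [hφ.map_dCoord_zero hε]
        refine not_small_of_inv_mem (neg_ne_zero.2 (inv_ne_zero hd0)) ?_
        rw [inv_neg_functionField, inv_inv]
        exact neg_mem h6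
    · have h6 := h₃.resolve_left h5
      have hr0 := rCoord_ne_zero (n - 1)
      have h7 : Small R (rCoord (n - 1))⁻¹ :=
        (small_or_inv_mem h6).resolve_right (by rwa [inv_inv])
      have h8 : Small R (algebraMap ℂ FunctionFieldP2 ε * (rCoord (n - 1))⁻¹) :=
        h7.mul_left (hR ε)
      have h9 := one_add_ne_zero_of_small h8
      have h10 : dCoord ε n 0 = rCoord (n - 1) *
          (1 + algebraMap ℂ FunctionFieldP2 ε * (rCoord (n - 1))⁻¹) := by
        rw [dCoord_zero]
        field_simp
      refine .overD 0 hn (hsm ?_) (hsm (by rwa [hs])) (hm ?_)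
      · rw [hφ.map_dCoord_zero hε, h10, mul_inv]
        exact (h7.mul_right (inv_one_add_mem h8)).neg
      · have h11 : rCoord (n - 1) * sCoord = rCoord (n - 2) := by
          have := rCoord_add_mul (n - 2) 1
          rwa [show n - 2 + 1 = n - 1 by omega, pow_one] at this
        rw [map_inv₀, hd, inv_neg_functionField, inv_inv, h10, pow_one, mul_right_comm, h11]
        exact neg_mem (mul_mem h₁.mem (add_mem (one_mem _) h8.mem))
  | overD k hk h₁ h₂ h₃ =>
    obtain ⟨j, rfl⟩ : ∃ j, n = k + j + 3 := ⟨n - k - 3, by omega⟩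
    set r := rCoord (k + j + 3 - 1) with hrdef
    have hb0 := dCoord_ne_zero ε (k + j + 3) k
    have h4 : dCoord ε (k + j + 3) 0 = dCoord ε (k + j + 3) k * sCoord ^ k := by
      have := dCoord_add_mul ε (k + j + 3) 0 k
      rw [← this, zero_add]
    have h5 : Small R (dCoord ε (k + j + 3) 0) := h4 ▸ h₁.mul_right (pow_mem h₂.mem k)
    have hr0 : r ≠ 0 := rCoord_ne_zero _
    have hrm : r ∈ R.toSubring := by
      rw [hrdef, rCoord_last ε]
      exact sub_mem h5.mem (hR ε)
    -- Over the `D_k`, `d_0` is small, so `r = d_0 - ε` is a unit and `φ r_{j+1}` is a unit times `1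
    -- / d_{k+1}`.
    have hri : r⁻¹ ∈ R.toSubring := by
      have := inv_const_add_mem hR (neg_ne_zero.2 hε0) h5
      rwa [map_neg, ← sub_eq_add_neg, ← rCoord_last] at this
    have h6 : r * sCoord ^ (k + 1) = rCoord (j + 1) := by
      rw [hrdef, show k + j + 3 - 1 = j + 1 + (k + 1) by omega, rCoord_add_mul]
    have h7 : φ (rCoord (j + 1)) = algebraMap ℂ FunctionFieldP2 ε * r *
        (dCoord ε (k + j + 3) (k + 1))⁻¹ := by
      rw [hr (by omega), ← h6, h4, dCoord_succ, pow_succ]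
      field_simp
    rcases small_or_inv_mem h₃ with h8 | h8
    · have h9 : Small R (φ (rCoord (j + 1))) := by
        rw [h7]
        exact h8.mul_left (mul_mem (hR ε) hrm)
      have h10 : Small R (φ (rCoord (j + 1 + 1))⁻¹) := by
        have h11 : φ (rCoord (j + 1 + 1))⁻¹ =
            dCoord ε (k + j + 3) k * (algebraMap ℂ FunctionFieldP2 ε⁻¹ * r⁻¹) := by
          rw [map_inv₀, rCoord_succ, map_div₀, h7, hs, dCoord_succ, map_inv₀]
          field_simp
        rw [h11]
        exact h₁.mul_right (mul_mem (hR _) hri)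
      rcases Nat.eq_zero_or_pos k with rfl | hk0
      · refine .overLastA (hsm ?_) (hsm (by rwa [hs])) (Or.inr (hm ?_)) (hns ?_)
        · rwa [show 0 + j + 3 - 2 = j + 1 by omega]
        · rw [show 0 + j + 3 - 1 = j + 1 + 1 by omega]
          exact h10.mem
        · rw [hφ.map_dCoord_zero hε]
          refine not_small_of_inv_mem (neg_ne_zero.2 (inv_ne_zero hd0)) ?_
          rw [inv_neg_functionField, inv_inv]
          exact neg_mem h5.mem
      · exact .overA (j + 1) (by omega) (hsm h9) (hsm (by rwa [hs])) (hm h10.mem)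
    · rw [inv_inv] at h8
      refine .overA j (by omega) (hsm ?_) (hsm (by rwa [hs])) (hm ?_)
      · rw [← rCoord_add_mul j 1, map_mul, pow_one, hs, h7]
        exact h₂.mul_left (mul_mem (mul_mem (hR ε) hrm) h₃)
      · rw [map_inv₀, h7, mul_inv, mul_inv, inv_inv, ← map_inv₀]
        exact mul_mem (mul_mem (hR _) hri) h8
  | overLastD h₁ h₂ h₃ =>
    obtain ⟨m, rfl⟩ : ∃ m, n = m + 3 := ⟨n - 3, by omega⟩
    rw [show m + 3 - 2 = m + 1 by omega] at h₁
    rw [show m + 3 - 1 = m + 1 + 1 by omega] at h₃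
    set r := rCoord (m + 3 - 1) with hrdef
    have hb0 := dCoord_ne_zero ε (m + 3) (m + 1)
    have h4 : dCoord ε (m + 3) 0 = dCoord ε (m + 3) (m + 1) * sCoord ^ (m + 1) := by
      have := dCoord_add_mul ε (m + 3) 0 (m + 1)
      rw [← this, zero_add]
    have h5 : Small R (dCoord ε (m + 3) 0) := h4 ▸ h₁.mul_right (pow_mem h₂.mem (m + 1))
    have hr0 : r ≠ 0 := rCoord_ne_zero _
    have hrm : r ∈ R.toSubring := by
      rw [hrdef, rCoord_last ε]
      exact sub_mem h5.mem (hR ε)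
    have hri : r⁻¹ ∈ R.toSubring := by
      have := inv_const_add_mem hR (neg_ne_zero.2 hε0) h5
      rwa [map_neg, ← sub_eq_add_neg, ← rCoord_last] at this
    have h6 : r * sCoord ^ (m + 2) = yP2 := by
      rw [hrdef, show m + 3 - 1 = 0 + (m + 2) by omega, rCoord_add_mul, rCoord_zero]
    have h7 : φ yP2 = algebraMap ℂ FunctionFieldP2 ε * r *
        (dCoord ε (m + 3) (m + 1 + 1))⁻¹ := by
      rw [hy, ← h6, h4, dCoord_succ _ _ (m + 1), pow_succ]
      field_simp
    -- Since `φ y` is a unit times `1 / d_{n-1}`, the image lies in the chart `y ≠ 0` of the plane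
    -- where `d_{n-1}` is finite; at its pole it lies over `A_0`.
    by_cases h8 : dCoord ε (m + 3) (m + 1 + 1) ∈ R.toSubring
    · refine .chartY (hm ?_) (hm (by rw [hs]; exact h₂.mem))
      rw [map_inv₀, h7, mul_inv, mul_inv, inv_inv, ← map_inv₀]
      exact mul_mem (mul_mem (hR _) hri) h8
    · have h9 := h₃.resolve_left h8
      have h10 : Small R (dCoord ε (m + 3) (m + 1 + 1))⁻¹ :=
        (small_or_inv_mem h9).resolve_right (by rwa [inv_inv])
      refine .overA 0 (by omega) (hsm ?_) (hsm (by rwa [hs])) (hm ?_)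
      · rw [rCoord_zero, h7]
        exact h10.mul_left (mul_mem (hR ε) hrm)
      · have h11 : φ (rCoord (0 + 1))⁻¹ =
            dCoord ε (m + 3) (m + 1) * (algebraMap ℂ FunctionFieldP2 ε⁻¹ * r⁻¹) := by
          rw [map_inv₀, rCoord_succ, map_div₀, rCoord_zero, h7, hs, dCoord_succ _ _ (m + 1), map_inv₀]
          field_simp
        rw [h11]
        exact mul_mem h₁.mem (mul_mem (hR _) hri)

end

/-! ### Isomorphism of the blowups, images of curves, minimality -/

section

variable {R S T D : LocalSubring FunctionFieldP2} {ε : ℂ} {n : ℕ}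
  {φ : FunctionFieldP2 ≃ₐ[ℂ] FunctionFieldP2}

theorem neg_sq_eq_one (hε : ε ^ 2 = 1) : (-ε) ^ 2 = 1 := by rw [neg_sq, hε]

theorem isSeparatedModel_blowupList (hn : 2 ≤ n) (ε : ℂ) :
    IsSeparatedModel (blowupList planeP2 (xiList ε n)) :=
  (areSuccessiveCentres_xiList hn ε).1.isIteratedBlowup.isSeparatedModel isSeparatedModel_planeP2

theorem IsShear.exists_image_le (hn : 3 ≤ n) (hε : ε ^ 2 = 1) (hφ : IsShear ε n φ)
    (hR : R ∈ blowupList planeP2 (xiList ε n)) :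
    ∃ S ∈ blowupList planeP2 (xiList (-ε) n), image φ S ≤ R := by
  have hC := containsConstants_of_mem_blowupList (by omega) hR
  obtain ⟨S, hS, hSR⟩ :=
    ((located_of_mem_blowupList hn hR).image_symm hn hε hφ hC).exists_le hn hC.image
  exact ⟨S, hS, (image_le_iff φ).2 hSR⟩

/-- Going to the source by the inverse and back gives `image φ S' ≤ R ≤ image φ S`. Separatedness of
the target forces `S' = S`, and the sandwich collapses to `R = image φ S`. -/
theorem IsShear.image_mem (hn : 3 ≤ n) (hε : ε ^ 2 = 1) (hφ : IsShear ε n φ)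
    (hS : S ∈ blowupList planeP2 (xiList (-ε) n)) :
    image φ S ∈ blowupList planeP2 (xiList ε n) := by
  obtain ⟨R, hR, hRS⟩ := (hφ.symm hε).exists_image_le hn (neg_sq_eq_one hε) hS
  rw [neg_neg] at hR
  obtain ⟨S', hS', hSR'⟩ := hφ.exists_image_le hn hε hR
  have h1 : R ≤ image φ S := by
    have := (image_le_iff φ.symm).1 hRS
    rwa [AlgEquiv.symm_symm] at this
  have h2 : S' = S := by
    refine (isSeparatedModel_blowupList (by omega) (-ε)).eq_of_le hS' hS ?_
    have := (image_le_iff φ).1 (hSR'.trans h1)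
    rwa [image_symm_image] at this
  rw [h2] at hSR'
  rwa [← le_antisymm h1 hSR']

theorem IsShear.isIsomorphism (hn : 3 ≤ n) (hε : ε ^ 2 = 1) (hφ : IsShear ε n φ) :
    IsIsomorphism φ (blowupList planeP2 (xiList ε n)) (blowupList planeP2 (xiList (-ε) n)) := by
  refine Set.Subset.antisymm ?_ fun R hR => ?_
  · rintro _ ⟨S, hS, rfl⟩
    exact hφ.image_mem hn hε hS
  · refine ⟨image φ.symm R, ?_, image_image_symm φ R⟩
    exact (hφ.symm hε).image_mem hn (neg_sq_eq_one hε) (by rwa [neg_neg])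

theorem IsShear.isRegularMap (hn : 3 ≤ n) (hε : ε ^ 2 = 1) (hφ : IsShear ε n φ) :
    IsRegularMap φ (blowupList planeP2 (xiList ε n)) planeP2 := by
  intro R hR
  obtain ⟨S, hS, hSR⟩ := hφ.exists_image_le hn hε hR
  obtain ⟨S', hS', hSS'⟩ :=
    (areSuccessiveCentres_xiList (by omega) (-ε)).1.isIteratedBlowup.exists_le hS
  exact ⟨S', hS', (image_mono φ hSS').trans hSR⟩

/-- This makes `Δ` the term of index `-1` of the family `G^k`, so it needs no separate computation
below. -/
theorem lineDelta_eq : lineDelta = curveAt (rCoord 0) sCoord := by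
  have h : IsCoordinates yP2 sCoord := rCoord_zero ▸ isCoordinates_rCoord 0
  have h' := isCoordinates_yP2_zP2
  rw [lineDelta_eq_curveAt, rCoord_zero]
  refine le_antisymm (curveAt_le h' (containsConstants_curveAt h) (nonconstant_curveAt h) ?_)
    (curveAt_le h (containsConstants_curveAt h') (nonconstant_curveAt h') ?_)
  · rw [zP2_eq]
    exact (small_curveAt h).mul_left (nonconstant_curveAt h).1
  · exact (small_curveAt h').mul_right (nonconstant_curveAt h').inv_mem

theorem exceptionalCurve_pointP : exceptionalCurve pointP = curveAt sCoord⁻¹ zP2 := by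
  rw [pointP, exceptionalCurve_originAt isCoordinates_yP2_zP2, sCoord_inv]

theorem exceptionalCurve_pointA (k : ℕ) :
    exceptionalCurve (pointA k) = curveAt (rCoord (k + 1)) sCoord := by
  rw [pointA, exceptionalCurve_originAt (isCoordinates_rCoord k), rCoord_succ]

theorem exceptionalCurve_pointD (ε : ℂ) (n k : ℕ) :
    exceptionalCurve (pointD ε n k) = curveAt (dCoord ε n (k + 1)) sCoord := by
  rw [pointD, exceptionalCurve_originAt (isCoordinates_dCoord ε n k), dCoord_succ]

/-- Along `s = 0` the coordinates correspond by `d'_{j+1} ↦ -1 / r_k`, a bijection of the two lines.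
Domination is checked in both directions. -/
theorem IsShear.image_curveAt_dCoord (hε : ε ^ 2 = 1) (hφ : IsShear ε n φ) {k j : ℕ}
    (h : k + (j + 1) + 1 = n) :
    image φ (curveAt (dCoord (-ε) n (j + 1)) sCoord) = curveAt (rCoord k) sCoord := by
  have hr := isCoordinates_rCoord k
  have hd := isCoordinates_dCoord (-ε) n (j + 1)
  have hs0 := sCoord_ne_zero
  have hCr := containsConstants_curveAt hr
  have hCd := containsConstants_curveAt hd
  have hφ' := hφ.symm hε
  have hr1 : rCoord (n - 1) * sCoord ^ (j + 1) = rCoord k := by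
    rw [show n - 1 = k + (j + 1) by omega, rCoord_add_mul]
  have key : ∀ ε : ℂ, dCoord ε n 0 * sCoord ^ (j + 1) =
      rCoord k + algebraMap ℂ FunctionFieldP2 ε * sCoord ^ (j + 1) := fun ε => by
    rw [dCoord_zero, add_mul, hr1]
  refine le_antisymm ((image_le_iff φ).2 (curveAt_le hd hCr.image ?_ ?_))
    (curveAt_le hr hCd.image ?_ ?_)
  · rw [nonconstant_image_iff, AlgEquiv.symm_symm, hφ.map_dCoord hε, key]
    exact (((nonconstant_curveAt hr).add_small
      (((small_curveAt hr).pow (by omega)).mul_left (hCr ε))).inv hCr).neg hCr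
  · rw [small_image_iff, AlgEquiv.symm_symm, hφ.1]
    exact small_curveAt hr
  · rw [nonconstant_image_iff, hφ'.map_rCoord (by omega)]
    -- The pullback of `r_k` under the inverse, split as `-1 / d'_{j+1}` plus a term that vanishes
    -- with `s`.
    have h1 : algebraMap ℂ FunctionFieldP2 (-ε) * rCoord k / dCoord (-ε) n 0 =
        (dCoord (-ε) n (j + 1))⁻¹ * algebraMap ℂ FunctionFieldP2 (-1) +
          algebraMap ℂ FunctionFieldP2 (-ε) * sCoord ^ (j + 1) := by
      have h2 : dCoord (-ε) n (j + 1) * sCoord ^ (j + 1) = dCoord (-ε) n 0 := by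
        have := dCoord_add_mul (-ε) n 0 (j + 1)
        rwa [zero_add] at this
      have hd0 := dCoord_ne_zero (-ε) n (j + 1)
      have h3 := key (-ε)
      rw [← h2] at h3 ⊢
      have h4 : rCoord k = dCoord (-ε) n (j + 1) * sCoord ^ (j + 1) * sCoord ^ (j + 1) -
          algebraMap ℂ FunctionFieldP2 (-ε) * sCoord ^ (j + 1) := by rw [h3]; ring
      rw [h4]
      have h5 := algebraMap_sq (neg_sq_eq_one hε)
      rw [map_neg _ (1 : ℂ), map_one]
      field_simp
      linear_combination -h5
    rw [h1, mul_comm]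
    exact (((nonconstant_curveAt hd).inv hCd).mul_const hCd (by simp)).add_small
      (((small_curveAt hd).pow (by omega)).mul_left (hCd _))
  · rw [small_image_iff, hφ'.1]
    exact small_curveAt hd

/-- Domination for the inverse shear is the reverse domination, so for a fixed curve one inequality,
uniform in `ε`, suffices. -/
theorem image_eq_of_forall_image_le (hε : ε ^ 2 = 1)
    (h : ∀ (ε : ℂ) (φ : FunctionFieldP2 ≃ₐ[ℂ] FunctionFieldP2), ε ^ 2 = 1 → IsShear ε n φ →
      image φ D ≤ D) (hφ : IsShear ε n φ) : image φ D = D := by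
  refine le_antisymm (h ε φ hε hφ) ?_
  have := (image_le_iff φ.symm).1 (h (-ε) φ.symm (neg_sq_eq_one hε) (hφ.symm hε))
  rwa [AlgEquiv.symm_symm] at this

theorem isCoordinates_sCoord_inv_zP2 : IsCoordinates sCoord⁻¹ zP2 :=
  sCoord_inv ▸ isCoordinates_yP2_zP2.div

theorem IsShear.image_exceptionalCurve_pointP (hn : 3 ≤ n) (hε : ε ^ 2 = 1)
    (hφ : IsShear ε n φ) : image φ (exceptionalCurve pointP) = exceptionalCurve pointP := by
  refine image_eq_of_forall_image_le hε (fun ε φ hε hφ => ?_) hφ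
  rw [exceptionalCurve_pointP]
  have h := isCoordinates_sCoord_inv_zP2
  have hC := containsConstants_curveAt h
  have hs := nonconstant_curveAt h
  have hz := small_curveAt h
  refine (image_le_iff φ).2 (curveAt_le h hC.image ?_ ?_)
  · rwa [nonconstant_image_iff, AlgEquiv.symm_symm, map_inv₀, hφ.1]
  · rw [small_image_iff, AlgEquiv.symm_symm, hφ.map_zP2 (by omega), div_eq_mul_inv]
    refine (hz.mul_left (hC ε)).mul_right ?_
    have hs0 := sCoord_ne_zero
    have h4 : rCoord (n - 1) = zP2 * sCoord⁻¹ ^ n := by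
      obtain ⟨m, rfl⟩ : ∃ m, n = m + 1 := ⟨n - 1, by omega⟩
      rw [Nat.add_sub_cancel, rCoord_eq, zP2_eq, pow_succ, inv_pow]
      field_simp
    rw [dCoord_zero, h4]
    refine inv_const_add_mem hC ?_ (hz.mul_right (pow_mem hs.1 n))
    rintro rfl
    simp at hε

theorem IsShear.image_exceptionalCurve_lastA (hn : 2 ≤ n) (hε : ε ^ 2 = 1)
    (hφ : IsShear ε n φ) :
    image φ (exceptionalCurve (pointA (n - 2))) = exceptionalCurve (pointA (n - 2)) := by
  refine image_eq_of_forall_image_le hε (fun ε φ hε hφ => ?_) hφ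
  rw [exceptionalCurve_pointA, show n - 2 + 1 = n - 1 by omega]
  have h := isCoordinates_rCoord (n - 1)
  have hC := containsConstants_curveAt h
  refine (image_le_iff φ).2 (curveAt_le h hC.image ?_ ?_)
  · have h1 : algebraMap ℂ FunctionFieldP2 ε * rCoord (n - 1) / dCoord ε n 0 =
        -(dCoord ε n 0)⁻¹ + algebraMap ℂ FunctionFieldP2 ε := by
      have hd0 := dCoord_ne_zero ε n 0
      rw [rCoord_last ε]
      field_simp
      linear_combination -algebraMap_sq hε
    rw [nonconstant_image_iff, AlgEquiv.symm_symm, hφ.2, h1, dCoord_zero]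
    exact ((((nonconstant_curveAt h).add_const hC ε).inv hC).neg hC).add_const hC ε
  · rw [small_image_iff, AlgEquiv.symm_symm, hφ.1]
    exact small_curveAt h

theorem IsShear.image_lineDelta (hn : 2 ≤ n) (hε : ε ^ 2 = 1) (hφ : IsShear ε n φ) :
    image φ lineDelta = exceptionalCurve (pointD ε n (n - 2)) := by
  -- The curve formula for the inverse at the end `k = 0` of the chain, where `r_0 = y` describes
  -- `Δ`.
  have h := (hφ.symm hε).image_curveAt_dCoord (neg_sq_eq_one hε) (k := 0) (j := n - 2) (by omega)
  rw [lineDelta_eq, ← h, neg_neg, exceptionalCurve_pointD, image_image_symm]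

theorem mem_xiList_pointP (hn : 2 ≤ n) (ε : ℂ) : pointP ∈ xiList ε n :=
  List.mem_map.2 ⟨0, by simp; omega, rfl⟩

theorem mem_xiList_pointA (ε : ℂ) {k : ℕ} (hk : k + 2 ≤ n) : pointA k ∈ xiList ε n :=
  List.mem_map.2 ⟨k + 1, by simp; omega, chainPoint_succ (by omega)⟩

theorem mem_xiList_pointD (ε : ℂ) {k : ℕ} (hk : k + 2 ≤ n) : pointD ε n k ∈ xiList ε n :=
  List.mem_map.2 ⟨n + k, by simp; omega, chainPoint_add (by omega) k⟩

theorem existsUnique_of_mem_xiList (hR : R ∈ xiList ε n) : ∃! D, IsExceptionalCurve R D := by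
  obtain ⟨i, -, rfl⟩ := List.mem_map.1 hR
  obtain ⟨u, v, h, he⟩ := exists_isCoordinates_chainPoint ε n i
  rw [he]
  exact existsUnique_isExceptionalCurve h

theorem exceptionalCurve_spec (hR : R ∈ xiList ε n) :
    exceptionalCurve R ∈ exceptionalFibre R ∧ ¬ IsClosedPoint (exceptionalCurve R) ∧
      IsDiscreteValuationRing (exceptionalCurve R).toSubring := by
  obtain ⟨i, -, rfl⟩ := List.mem_map.1 hR
  obtain ⟨u, v, h, he⟩ := exists_isCoordinates_chainPoint ε n i
  rw [he, exceptionalCurve_originAt h]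
  exact ⟨curveAt_mem_exceptionalFibre h, not_isClosedPoint_curveAt h.div,
    isDiscreteValuationRing_curveAt h.div⟩

theorem exceptionalCurve_mem_blowupList (hR : R ∈ xiList ε n) :
    exceptionalCurve R ∈ blowupList planeP2 (xiList ε n) :=
  mem_blowupList_of_not_isClosedPoint (fun _ => isClosedPoint_of_mem_xiList)
    (exceptionalCurve_spec hR).2.1 (Or.inr ⟨R, hR, (exceptionalCurve_spec hR).1⟩)

theorem lineDelta_mem_blowupList (ε : ℂ) (n : ℕ) :
    lineDelta ∈ blowupList planeP2 (xiList ε n) :=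
  mem_blowupList_of_not_isClosedPoint (fun _ => isClosedPoint_of_mem_xiList)
    (not_isClosedPoint_curveAt isCoordinates_yP2_zP2) (Or.inl lineDelta_mem_planeP2)

/-- The centres of the blowups are points of indeterminacy. -/
theorem IsShear.not_image_le (hn : 2 ≤ n) (hε : ε ^ 2 = 1) (hφ : IsShear ε n φ)
    (hR : R ∈ xiList ε n) (hS : S ∈ planeP2) : ¬ image φ S ≤ R := by
  intro h
  have hl := mem_xiList_pointD ε (n := n) (k := n - 2) (by omega)
  obtain ⟨h1, h2, -⟩ := exceptionalCurve_spec hl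
  have hRD : R ≤ exceptionalCurve (pointD ε n (n - 2)) := by
    refine le_trans ?_ h1.1
    obtain ⟨i, hi, rfl⟩ := List.mem_map.1 hR
    rw [← chainPoint_add (by omega)]
    rw [List.mem_range] at hi
    exact chain_le (N := 2 * n - 1) (fun i _ => chainPoint_succ_mem hn i) (by omega) (by omega)
  rw [← hφ.image_lineDelta hn hε] at hRD h2
  -- `S` and `Δ` are both in the plane, and `S` is dominated by `Δ`. Then `R` equals the image of
  -- `Δ`, which is not a closed point.
  have h3 : S = lineDelta := by
    refine isSeparatedModel_planeP2.eq_of_le hS lineDelta_mem_planeP2 ?_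
    have := (image_le_iff φ).1 (h.trans hRD)
    rwa [image_symm_image] at this
  rw [h3] at h
  rw [le_antisymm h hRD] at h2
  exact h2 (isClosedPoint_of_mem_xiList hR)

theorem IsShear.isMinimalDesingularization (hn : 3 ≤ n) (hε : ε ^ 2 = 1) (hφ : IsShear ε n φ) :
    IsMinimalDesingularization φ planeP2 planeP2 (blowupList planeP2 (xiList ε n)) := by
  have hc := (areSuccessiveCentres_xiList (by omega : 2 ≤ n) ε).1
  refine ⟨hc.isIteratedBlowup, hφ.isRegularMap hn hε, fun X hX hreg => ?_⟩
  refine hc.isIteratedBlowup_of_notMem isSeparatedModel_planeP2 hX fun R hR hRX => ?_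
  obtain ⟨S, hS, hSR⟩ := hreg R hRX
  exact hφ.not_image_le (by omega) hε hR hS hSR

theorem IsShear.mapsCurve (hn : 3 ≤ n) (hε : ε ^ 2 = 1) (hφ : IsShear ε n φ)
    {D' : LocalSubring FunctionFieldP2} (hD' : D' ∈ blowupList planeP2 (xiList (-ε) n))
    (hD : IsDiscreteValuationRing D.toSubring) (h : image φ D' = D) :
    MapsCurve φ (blowupList planeP2 (xiList ε n)) (blowupList planeP2 (xiList (-ε) n)) D D' :=
  ⟨h ▸ hφ.image_mem hn hε hD', hD', hD, h⟩

/-! ### The comorphism of `Φ_n` exists and is a shear -/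

theorem exists_algEquiv {u v : FunctionFieldP2} (h : IsCoordinates u v) :
    ∃ φ : FunctionFieldP2 ≃ₐ[ℂ] FunctionFieldP2, φ yP2 = u ∧ φ zP2 = v := by
  let f : FunctionFieldP2 →ₐ[ℂ] FunctionFieldP2 :=
    IsFractionRing.liftAlgHom (g := MvPolynomial.aeval ![u, v])
      (algebraicIndependent_iff_injective_aeval.1 h.1)
  have hy : f yP2 = u := by
    simp [f, yP2, IsFractionRing.liftAlgHom_apply, IsFractionRing.lift_algebraMap]
  have hz : f zP2 = v := by
    simp [f, zP2, IsFractionRing.liftAlgHom_apply, IsFractionRing.lift_algebraMap]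
  have hf : f.fieldRange = ⊤ := h.2 _ ⟨yP2, hy⟩ ⟨zP2, hz⟩
  have hsurj : Function.Surjective f := AlgHom.fieldRange_eq_top.1 hf
  exact ⟨AlgEquiv.ofBijective f ⟨f.injective, hsurj⟩, hy, hz⟩

theorem algEquiv_ext {φ ψ : FunctionFieldP2 ≃ₐ[ℂ] FunctionFieldP2} (hy : φ yP2 = ψ yP2)
    (hz : φ zP2 = ψ zP2) : φ = ψ := by
  let E : IntermediateField ℂ FunctionFieldP2 :=
    (AlgHom.equalizer (φ : FunctionFieldP2 →ₐ[ℂ] FunctionFieldP2) ψ).toIntermediateField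
      fun x hx => by
        have hx' : φ x = ψ x := hx
        change φ x⁻¹ = ψ x⁻¹
        rw [map_inv₀, map_inv₀, hx']
  have hE : E = ⊤ := isCoordinates_yP2_zP2.2 E hy hz
  ext x
  have hx : x ∈ E := hE ▸ trivial
  exact hx

/-- On `x = 1` the first component is `z ^ (n - 1) + y ^ n = z ^ (n - 1) (r + 1)`; dividing the
other two by it gives the formulas. -/
theorem isComorphism_iff (hn : 1 ≤ n) : IsComorphism (PhiMap n) φ ↔
    φ yP2 = yP2 / dCoord 1 n 0 ∧ φ zP2 = zP2 / dCoord 1 n 0 := by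
  obtain ⟨m, rfl⟩ : ∃ m, n = m + 1 := ⟨n - 1, by omega⟩
  have hz0 := zP2_ne_zero
  have hd0 := dCoord_ne_zero 1 (m + 1) 0
  have hF : zP2 ^ m + yP2 ^ (m + 1) = zP2 ^ m * dCoord 1 (m + 1) 0 := by
    rw [dCoord_zero, map_one, Nat.add_sub_cancel, rCoord]
    field_simp
    ring
  have h0 : MvPolynomial.aeval homCoord (PhiMap (m + 1) 0) =
      zP2 ^ m * dCoord 1 (m + 1) 0 := by
    simp [PhiMap, homCoord, hF]
  have h1 : MvPolynomial.aeval homCoord (PhiMap (m + 1) 1) = yP2 * zP2 ^ m := by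
    simp [PhiMap, homCoord]
  have h2 : MvPolynomial.aeval homCoord (PhiMap (m + 1) 2) = zP2 ^ (m + 1) := by
    simp [PhiMap, homCoord]
  constructor
  · rintro ⟨-, h⟩
    have h3 := h 1 0
    have h4 := h 2 0
    rw [h0, h1] at h3
    rw [h0, h2] at h4
    simp only [homCoord, Matrix.cons_val_zero, Matrix.cons_val_one, Matrix.cons_val, map_one]
      at h3 h4
    constructor
    · field_simp
      refine mul_right_cancel₀ (pow_ne_zero m hz0) ?_
      linear_combination h3
    · field_simp
      refine mul_right_cancel₀ (pow_ne_zero m hz0) ?_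
      linear_combination h4
  · rintro ⟨h3, h4⟩
    refine ⟨⟨2, by rw [h2]; exact pow_ne_zero _ hz0⟩, ?_⟩
    have key : ∀ i, φ (homCoord i) * (zP2 ^ m * dCoord 1 (m + 1) 0) =
        MvPolynomial.aeval homCoord (PhiMap (m + 1) i) := by
      intro i
      fin_cases i
      · simp only [Fin.zero_eta, h0]
        simp [homCoord]
      · simp only [Fin.mk_one, h1]
        simp only [homCoord, Matrix.cons_val_one, Matrix.cons_val_zero, h3]
        field_simp
      · simp only [Fin.reduceFinMk, h2]
        simp only [homCoord, Matrix.cons_val, h4]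
        field_simp
        ring
    intro i j
    rw [← key i, ← key j]
    ring

theorem isShear_of_isComorphism (hn : 1 ≤ n) (h : IsComorphism (PhiMap n) φ) :
    IsShear 1 n φ := by
  obtain ⟨hy, hz⟩ := (isComorphism_iff hn).1 h
  obtain ⟨m, rfl⟩ : ∃ m, n = m + 1 := ⟨n - 1, by omega⟩
  have hz0 := zP2_ne_zero
  have hy0 := yP2_ne_zero
  have hd0 := dCoord_ne_zero 1 (m + 1) 0
  constructor
  · rw [sCoord, map_div₀, hy, hz]
    field_simp
  · rw [Nat.add_sub_cancel, rCoord, map_div₀, map_pow, map_pow, hy, hz, map_one, div_pow, div_pow, pow_succ]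
    field_simp
    ring

theorem exists_isComorphism (hn : 1 ≤ n) :
    ∃ φ : FunctionFieldP2 ≃ₐ[ℂ] FunctionFieldP2, IsComorphism (PhiMap n) φ := by
  have hd0 := dCoord_ne_zero 1 n 0
  have hs0 := sCoord_ne_zero
  have h1 : IsCoordinates (yP2 / dCoord 1 n 0) sCoord := by
    -- This first coordinate is `r / (r + 1)`, a Möbius function of `r`; multiplying it by `s ^ (n -
    -- 1)` gives `y / (r + 1)`.
    have h2 : IsCoordinates (-(dCoord 1 n 0)⁻¹ + 1) sCoord := by
      refine (isCoordinates_dCoord 1 n 0).of_forall_mem fun E h1 h2 => ⟨?_, h2⟩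
      have := E.inv_mem (E.neg_mem (E.sub_mem h1 E.one_mem))
      simpa using this
    refine h2.of_forall_mem fun E h3 h4 => ⟨?_, h4⟩
    have h5 : -(dCoord 1 n 0)⁻¹ + 1 = yP2 / dCoord 1 n 0 / sCoord ^ (n - 1) := by
      have h6 := rCoord_last 1 n
      rw [rCoord_eq, map_one] at h6
      rw [div_right_comm, h6]
      field_simp
      ring
    rw [h5]
    exact E.div_mem h3 (pow_mem h4 (n - 1))
  have h2 : IsCoordinates (yP2 / dCoord 1 n 0) (zP2 / dCoord 1 n 0) := by
    refine h1.of_forall_mem fun E h3 h4 => ⟨h3, ?_⟩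
    have h5 : sCoord = zP2 / dCoord 1 n 0 / (yP2 / dCoord 1 n 0) := by
      have hy0 := yP2_ne_zero
      rw [sCoord]
      field_simp
    rw [h5]
    exact E.div_mem h4 h3
  obtain ⟨φ, hφ⟩ := exists_algEquiv h2
  exact ⟨φ, (isComorphism_iff hn).2 hφ⟩

end

end ZariskiModel

end

open ZariskiModel
theorem proposition2p1 (n : ℕ) (hn : 3 ≤ n) :
    -- `Φ_n` is a birational self-map of the plane, with comorphism `φ`
    (∃! φ : FunctionFieldP2 ≃ₐ[ℂ] FunctionFieldP2, IsComorphism (PhiMap n) φ) ∧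
    -- `ξ̂₁` and `ξ̂₂` are points of length `2n - 1` infinitely near `P`
    IsInfinitelyNear planeP2 pointP (2 * n - 1) (xiOne n) ∧
    IsInfinitelyNear planeP2 pointP (2 * n - 1) (xiTwo n) ∧
    (∀ R, R ∈ xiOne n ∨ R ∈ xiTwo n → ∃! D, IsExceptionalCurve R D) ∧
    ∀ φ : FunctionFieldP2 ≃ₐ[ℂ] FunctionFieldP2, IsComorphism (PhiMap n) φ →
      -- they correspond to the minimal desingularization of `Φ_n`
      IsMinimalDesingularization φ planeP2 planeP2 (blowupList planeP2 (xiOne n)) ∧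
      IsMinimalDesingularization φ.symm planeP2 planeP2 (blowupList planeP2 (xiTwo n)) ∧
      IsIsomorphism φ (blowupList planeP2 (xiOne n)) (blowupList planeP2 (xiTwo n)) ∧
      -- `Δ → M^{n-2}`, `E → E`, `G^{n-2} → G^{n-2}`, `L^{n-2} → Δ`
      MapsCurve φ (blowupList planeP2 (xiOne n)) (blowupList planeP2 (xiTwo n))
        lineDelta (exceptionalCurve (pointC n (n - 2))) ∧
      MapsCurve φ (blowupList planeP2 (xiOne n)) (blowupList planeP2 (xiTwo n))
        (exceptionalCurve pointP) (exceptionalCurve pointP) ∧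
      MapsCurve φ (blowupList planeP2 (xiOne n)) (blowupList planeP2 (xiTwo n))
        (exceptionalCurve (pointA (n - 2))) (exceptionalCurve (pointA (n - 2))) ∧
      MapsCurve φ (blowupList planeP2 (xiOne n)) (blowupList planeP2 (xiTwo n))
        (exceptionalCurve (pointB n (n - 2))) lineDelta ∧
      -- `G^k → M^{n-3-k}` for `0 ≤ k ≤ n - 3`, where `G^0 = F` and `M^0 = K`
      (∀ k j : ℕ, k + j + 3 = n →
        MapsCurve φ (blowupList planeP2 (xiOne n)) (blowupList planeP2 (xiTwo n))
          (exceptionalCurve (pointA k)) (exceptionalCurve (pointC n j))) ∧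
      -- `L^ℓ → G^{n-3-ℓ}` for `0 ≤ ℓ ≤ n - 3`, where `L^0 = H` and `G^0 = F`
      (∀ l j : ℕ, l + j + 3 = n →
        MapsCurve φ (blowupList planeP2 (xiOne n)) (blowupList planeP2 (xiTwo n))
          (exceptionalCurve (pointB n l)) (exceptionalCurve (pointA j))) := by
  have hn0 : n ≠ 0 := by omega
  have h1 : (1 : ℂ) ^ 2 = 1 := one_pow 2
  simp only [xiOne_eq hn0, xiTwo_eq hn0, pointB_eq, pointC_eq]
  refine ⟨?_, isInfinitelyNear_xiList (by omega) 1, isInfinitelyNear_xiList (by omega) (-1),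
    fun R hR => hR.elim existsUnique_of_mem_xiList existsUnique_of_mem_xiList, fun φ h => ?_⟩
  · obtain ⟨φ, hφ⟩ := exists_isComorphism (n := n) (by omega)
    refine ⟨φ, hφ, fun ψ hψ => ?_⟩
    have h2 := (isComorphism_iff (by omega)).1 hφ
    have h3 := (isComorphism_iff (by omega)).1 hψ
    exact algEquiv_ext (h3.1.trans h2.1.symm) (h3.2.trans h2.2.symm)
  have hφ := isShear_of_isComorphism (by omega) h
  have hφ' := hφ.symm h1
  have hmem : ∀ {R}, R ∈ xiList (-1) n →
      exceptionalCurve R ∈ blowupList planeP2 (xiList (-1) n) := exceptionalCurve_mem_blowupList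
  refine ⟨hφ.isMinimalDesingularization hn h1,
    hφ'.isMinimalDesingularization hn (neg_sq_eq_one h1), hφ.isIsomorphism hn h1, ?_, ?_, ?_, ?_,
    fun k j hkj => ?_, fun l j hlj => ?_⟩
  · refine hφ.mapsCurve hn h1 (hmem (mem_xiList_pointD _ (by omega)))
      (isDiscreteValuationRing_curveAt isCoordinates_yP2_zP2) ?_
    rw [exceptionalCurve_pointD, lineDelta_eq]
    exact hφ.image_curveAt_dCoord h1 (by omega)
  · have hP := mem_xiList_pointP (n := n) (by omega) (-1)
    exact hφ.mapsCurve hn h1 (hmem hP) (exceptionalCurve_spec hP).2.2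
      (hφ.image_exceptionalCurve_pointP hn h1)
  · have hA := mem_xiList_pointA (n := n) (-1) (k := n - 2) (by omega)
    exact hφ.mapsCurve hn h1 (hmem hA) (exceptionalCurve_spec hA).2.2
      (hφ.image_exceptionalCurve_lastA (by omega) h1)
  · have hB := mem_xiList_pointD (n := n) 1 (k := n - 2) (by omega)
    exact hφ.mapsCurve hn h1 (lineDelta_mem_blowupList _ _) (exceptionalCurve_spec hB).2.2
      (hφ.image_lineDelta (by omega) h1)
  · have hA := mem_xiList_pointA (n := n) (-1) (k := k) (by omega)
    refine hφ.mapsCurve hn h1 (hmem (mem_xiList_pointD _ (by omega)))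
      (exceptionalCurve_spec hA).2.2 ?_
    rw [exceptionalCurve_pointD, exceptionalCurve_pointA]
    exact hφ.image_curveAt_dCoord h1 (by omega)
  · have hB := mem_xiList_pointD (n := n) 1 (k := l) (by omega)
    refine hφ.mapsCurve hn h1 (hmem (mem_xiList_pointA _ (by omega)))
      (exceptionalCurve_spec hB).2.2 ?_
    -- The curves over the `B_l` are reached through the inverse shear; `G^j` has coordinate
    -- `r_{j+1}`, hence `k := j + 1`.
    have h2 := hφ'.image_curveAt_dCoord (neg_sq_eq_one h1) (k := j + 1) (j := l) (by omega)
    rw [exceptionalCurve_pointD, exceptionalCurve_pointA, ← h2, image_image_symm, neg_neg]
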